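/- Let $\mathbb{D}$ be the open unit disk. A semigroup is a family $(F_t)_{t\ge 0}$ of holomorphic self-maps of $\mathbb{D}$ with $F_0=\mathrm{id}$ and $F_{s+t}=F_s\circ F_t$ for $s,t\ge0$; its generator is the function $f$ holomorphic in $\mathbb{D}$ with $f(z)=\lim_{t\to0^+}\frac{z-F_t(z)}{t}$ for all $z\in\mathbb{D}$ (where this limit exists for every $z$ and is holomorphic), and a point $a\in\overline{\mathbb{D}}$ is its Denjoy–Wolff point if $F_t(z)\to a$ as $t\to\infty$ for every $z\in\mathbb{D}$. A semigroup generator is a function that is the generator of some semigroup. For $|\zeta|=1$, $\angle\lim_{z\to\zeta}$ denotes the angular (nontangential) limit, i.e. the limit within each region $\{z\in\mathbb{D}:|z-\zeta|<M(1-|z|)\}$, $M>1$. The point $\zeta$ is a boundary regular null point of $f$ if $\angle\lim_{z\to\zeta}f(z)=0$ and the angular derivative $f'(\zeta):=\angle\lim_{z\to\zeta}\frac{f(z)}{z-\zeta}$ exists and is finite. **Theorem.** Let $f$ be the generator of a semigroup on $\mathbb{D}$ with Denjoy–Wolff point $1$, and let $\zeta_1,\dots,\zeta_N\in\partial\mathbb{D}\setminus\{1\}$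 be distinct boundary regular null points of $f$. Then $f$ has no zeros in $\mathbb{D}$; the point $1$ is a boundary regular null point of $f$ with $f'(1)$ real and $f'(1)\ge0$; each $f'(\zeta_n)$ is a negative real number; and there exist a number $r\ge0$ and a semigroup generator $h$ on $\mathbb{D}$ without zeros in $\mathbb{D}$ such that $$\frac{1}{f(z)}=\sum_{n=1}^{N}\frac{1}{|f'(\zeta_n)|}\Big(\frac{1}{z-1}-\frac{1}{z-\zeta_n}\Big)+\frac{r}{h(z)}\qquad(z\in\mathbb{D}),$$ the point $1$ is a boundary regular null point of $h$ with $h'(1)=f'(1)$, and $$\angle\lim_{z\to\zeta_n}\frac{h(z)}{z-\zeta_n}=\infty\qquad\text{for all } n=1,\dots,N.$$ -/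

import Mathlib

open Filter Topology

/-- The open unit disk of the complex plane. -/
def unitDisk : Set ℂ := Metric.ball 0 1

/-- A one-parameter semigroup with continuous time of holomorphic self-mappings of the unit disk.
Only the maps `F t` with `0 ≤ t`, restricted to the disk, are meaningful. -/
structure IsHolomorphicSemigroup (F : ℝ → ℂ → ℂ) : Prop where
  differentiableOn : ∀ t, 0 ≤ t → DifferentiableOn ℂ (F t) unitDisk
  mapsTo : ∀ t, 0 ≤ t → Set.MapsTo (F t) unitDisk unitDisk
  map_add : ∀ s t, 0 ≤ s → 0 ≤ t → ∀ z ∈ unitDisk, F (s + t) z = F s (F t z)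
  map_zero : ∀ z ∈ unitDisk, F 0 z = z

/-- `f` is the infinitesimal generator of the family `F`: it is holomorphic in the disk, and
`f z` is the limit of `(z - F t z) / t` as `t → 0⁺`, for each `z` in the disk.
(The existence of the limit contains the right continuity of `t ↦ F t z` at `t = 0`.) -/
def IsGeneratorOf (f : ℂ → ℂ) (F : ℝ → ℂ → ℂ) : Prop :=
  DifferentiableOn ℂ f unitDisk ∧
    ∀ z ∈ unitDisk, Tendsto (fun t : ℝ => (z - F t z) / (t : ℂ)) (𝓝[>] 0) (𝓝 (f z))

/-- `f` is a semigroup generator on the unit disk. -/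
def IsSemigroupGenerator (f : ℂ → ℂ) : Prop :=
  ∃ F : ℝ → ℂ → ℂ, IsHolomorphicSemigroup F ∧ IsGeneratorOf f F

/-- `a` is the Denjoy–Wolff point of the semigroup `F`. -/
def IsDenjoyWolffPoint (F : ℝ → ℂ → ℂ) (a : ℂ) : Prop :=
  ∀ z ∈ unitDisk, Tendsto (fun t : ℝ => F t z) atTop (𝓝 a)

/-- The nontangential approach region in the disk with vertex `ζ` and aperture `M`
(empty for `M ≤ 1` if `ζ` lies on the unit circle). -/
def stolzRegion (ζ : ℂ) (M : ℝ) : Set ℂ :=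
  {z | z ∈ unitDisk ∧ ‖z - ζ‖ < M * (1 - ‖z‖)}

/-- `φ z` tends to `l` as `z → ζ` nontangentially (in the angular sense). A finite angular limit
`c` is expressed by `l = 𝓝 c`, the angular limit `∞` by `l = Bornology.cobounded ℂ`. -/
def AngularTendsto (φ : ℂ → ℂ) (ζ : ℂ) (l : Filter ℂ) : Prop :=
  ∀ M : ℝ, Tendsto φ (𝓝[stolzRegion ζ M] ζ) l

/-- `f` has the angular limit `w` and the finite angular derivative `d` at the boundary point `ζ`.
For `w = 0`, this says that `ζ` is a boundary regular null point of `f`, with `f'(ζ) = d`. -/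
def HasAngularDeriv (f : ℂ → ℂ) (ζ w d : ℂ) : Prop :=
  AngularTendsto f ζ (𝓝 w) ∧ AngularTendsto (fun z => (f z - w) / (z - ζ)) ζ (𝓝 d)

/-! By Berkson–Porta, a generator with Denjoy–Wolff point `1` has the form `f = -(1 - z)² p` with
`Re p ≥ 0`. It has no zeros, because a zero would be a fixed point of the semigroup. Hence `q = 1/p`
also has nonnegative real part, and `1/f = -q/(1 - z)²`.

A boundary regular null point `ζ` of `f` is a point mass `c > 0` of the Herglotz measure of `q`.
Comparing angular limits gives `f'(ζ) = -|1 - ζ|²/(2c)`, which is negative. Up to an imaginary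
constant, the summand of the theorem attached to `ζ` is the Herglotz kernel of this mass
(`kernel_at_one_eq`). Subtracting the sum therefore removes the masses and leaves a function `q₂`
with `Re q₂ ≥ 0` and no mass at any `ζ n` (`exists_point_mass`, `re_sub_sum_kernel_nonneg`).

Write `q₂ = r g` and `h = -(1 - z)²/g`. The converse half of Berkson–Porta
(`isSemigroupGenerator_of_re_nonneg`) makes `h` a generator; the missing masses of `g` give the
infinite limits at `ζ n`. The constant `r` is fixed by `h'(1) = f'(1)`, that is `r = 1 - f'(1) ∑
1/|f'(ζ n)|`; it vanishes exactly when `q₂ = 0`.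

The converse half is proved by linearization: a primitive of `q/(1 - z)²` is injective, its image is
invariant under translations to the right, and these translations pull back to the semigroup. -/

/-! ### Schwarz–Pick and Harnack estimates. -/

open ComplexConjugate in
theorem normSq_one_sub_conj_mul_sub (z a : ℂ) :
    ‖1 - conj a * z‖ ^ 2 - ‖z - a‖ ^ 2 = (1 - ‖z‖ ^ 2) * (1 - ‖a‖ ^ 2) := by
  simp only [Complex.sq_norm, Complex.normSq_apply, Complex.sub_re, Complex.sub_im, Complex.mul_re,
    Complex.mul_im, Complex.conj_re, Complex.conj_im, Complex.one_re, Complex.one_im]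
  ring

open ComplexConjugate in
-- Half-plane analogue of the preceding identity: it shows that `(A - a) / (A + conj a)` has modulus
-- below `1` when both real parts are positive.
theorem normSq_add_conj_sub (A a : ℂ) :
    ‖A + conj a‖ ^ 2 - ‖A - a‖ ^ 2 = 4 * A.re * a.re := by
  simp only [Complex.sq_norm, Complex.normSq_apply, Complex.sub_re, Complex.sub_im,
    Complex.add_re, Complex.add_im, Complex.conj_re, Complex.conj_im]
  ring

theorem mem_unitDisk {z : ℂ} : z ∈ unitDisk ↔ ‖z‖ < 1 := by
  simp [unitDisk]

theorem isOpen_unitDisk : IsOpen unitDisk := Metric.isOpen_ball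

theorem one_sub_normSq_pos {z : ℂ} (hz : z ∈ unitDisk) : 0 < 1 - ‖z‖ ^ 2 := by
  have := mem_unitDisk.1 hz
  nlinarith [norm_nonneg z]

open ComplexConjugate in
theorem norm_sub_lt_norm_one_sub_conj_mul {z a : ℂ} (hz : z ∈ unitDisk) (ha : a ∈ unitDisk) :
    ‖z - a‖ < ‖1 - conj a * z‖ := by
  have h := normSq_one_sub_conj_mul_sub z a
  have := mul_pos (one_sub_normSq_pos hz) (one_sub_normSq_pos ha)
  exact lt_of_pow_lt_pow_left₀ 2 (norm_nonneg _) (by linarith)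

open ComplexConjugate in
theorem one_sub_conj_mul_ne_zero {z a : ℂ} (hz : z ∈ unitDisk) (ha : a ∈ unitDisk) :
    1 - conj a * z ≠ 0 :=
  norm_pos_iff.1 ((norm_nonneg _).trans_lt (norm_sub_lt_norm_one_sub_conj_mul hz ha))

open ComplexConjugate in
/-- The Schwarz lemma for a zero at an arbitrary point of the disk. -/
theorem norm_mul_le_of_zero {T : ℂ → ℂ} (hT : DifferentiableOn ℂ T unitDisk)
    (hmaps : ∀ z ∈ unitDisk, ‖T z‖ ≤ 1) {a z : ℂ} (ha : a ∈ unitDisk) (hz : z ∈ unitDisk)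
    (h0 : T a = 0) : ‖T z‖ * ‖1 - conj a * z‖ ≤ ‖z - a‖ := by
  have hna : -a ∈ unitDisk := by simpa [mem_unitDisk] using ha
  have hden : ∀ ξ ∈ unitDisk, 1 + conj a * ξ ≠ 0 := fun ξ hξ => by
    simpa using one_sub_conj_mul_ne_zero hξ hna
  have hψ : Set.MapsTo (fun ξ => (ξ + a) / (1 + conj a * ξ)) unitDisk unitDisk := by
    intro ξ hξ
    have := norm_sub_lt_norm_one_sub_conj_mul hξ hna
    simp only [map_neg, neg_mul, sub_neg_eq_add] at this
    rw [mem_unitDisk, norm_div, div_lt_one (norm_pos_iff.2 (hden ξ hξ))]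
    exact this
  have hψd : DifferentiableOn ℂ (fun ξ => (ξ + a) / (1 + conj a * ξ)) unitDisk :=
    (by fun_prop : DifferentiableOn ℂ (fun ξ => ξ + a) unitDisk).div (by fun_prop) hden
  have hne := one_sub_conj_mul_ne_zero hz ha
  have hpos := norm_pos_iff.2 hne
  have hξ : ‖(z - a) / (1 - conj a * z)‖ < 1 := by
    rw [norm_div, div_lt_one hpos]
    exact norm_sub_lt_norm_one_sub_conj_mul hz ha
  have hback : ((z - a) / (1 - conj a * z) + a) / (1 + conj a * ((z - a) / (1 - conj a * z)))
      = z := by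
    have h1 := hden _ (mem_unitDisk.2 hξ)
    rw [div_eq_iff h1]
    linear_combination div_mul_cancel₀ (z - a) hne
  -- The disk automorphism taking `0` to `a` reduces the claim to the Schwarz lemma at the origin.
  have key := Complex.norm_le_norm_of_mapsTo_ball (f := T ∘ fun ξ => (ξ + a) / (1 + conj a * ξ))
    (R := 1) (hT.comp hψd hψ) (fun ξ hξ => by
      simpa using hmaps _ (hψ hξ)) (by simp [h0]) hξ
  simp only [Function.comp_apply, hback] at key
  rwa [norm_div, le_div_iff₀ hpos] at key

open ComplexConjugate in
/-- The Schwarz-Pick lemma. -/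
theorem schwarz_pick {g : ℂ → ℂ} (hg : DifferentiableOn ℂ g unitDisk)
    (hmaps : Set.MapsTo g unitDisk unitDisk) {a z : ℂ} (ha : a ∈ unitDisk) (hz : z ∈ unitDisk) :
    ‖g z - g a‖ * ‖1 - conj a * z‖ ≤ ‖z - a‖ * ‖1 - conj (g a) * g z‖ := by
  have hpos := fun w (hw : w ∈ unitDisk) =>
    norm_pos_iff.2 (one_sub_conj_mul_ne_zero (hmaps hw) (hmaps ha))
  have key := norm_mul_le_of_zero (T := fun w => (g w - g a) / (1 - conj (g a) * g w))
    ((hg.sub_const _).div ((hg.const_mul _).const_sub _)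
      fun w hw => norm_pos_iff.1 (hpos w hw))
    (fun w hw => by
      rw [norm_div, div_le_one (hpos w hw)]
      exact (norm_sub_lt_norm_one_sub_conj_mul (hmaps hw) (hmaps ha)).le) ha hz (by simp)
  simp only [norm_div] at key
  rwa [div_mul_eq_mul_div, div_le_iff₀ (hpos z hz)] at key

open ComplexConjugate in
/-- The Schwarz-Pick lemma for functions with values in the right half-plane. -/
theorem schwarz_pick_re_nonneg {g : ℂ → ℂ} (hg : DifferentiableOn ℂ g unitDisk)
    (hre : ∀ z ∈ unitDisk, 0 ≤ (g z).re) {a z : ℂ} (ha : a ∈ unitDisk) (hz : z ∈ unitDisk) :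
    ‖g z - g a‖ * ‖1 - conj a * z‖ ≤ ‖z - a‖ * ‖g z + conj (g a)‖ := by
  -- Adding `ε` makes the real parts strictly positive, so the denominator of the Cayley quotient
  -- cannot vanish.
  have main : ∀ ε : ℝ, 0 < ε →
      ‖g z - g a‖ * ‖1 - conj a * z‖ ≤ ‖z - a‖ * ‖g z + ε + conj (g a + ε)‖ := by
    intro ε hε
    have hre' : ∀ w ∈ unitDisk, 0 < (g w + ε).re := fun w hw => by
      have := hre w hw
      simp only [Complex.add_re, Complex.ofReal_re]; linarith
    have hlt : ∀ w ∈ unitDisk, ‖g w + ε - (g a + ε)‖ < ‖g w + ε + conj (g a + ε)‖ := by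
      intro w hw
      have h := normSq_add_conj_sub (g w + ε) (g a + ε)
      have := mul_pos (hre' w hw) (hre' a ha)
      exact lt_of_pow_lt_pow_left₀ 2 (norm_nonneg _) (by linarith)
    have hpos := fun w hw => (norm_nonneg _).trans_lt (hlt w hw)
    have key := norm_mul_le_of_zero
      (T := fun w => (g w + ε - (g a + ε)) / (g w + ε + conj (g a + ε)))
      (((hg.add_const _).sub_const _).div ((hg.add_const _).add_const _)
        fun w hw => norm_pos_iff.1 (hpos w hw))
      (fun w hw => by
        rw [norm_div, div_le_one (hpos w hw)]
        exact (hlt w hw).le) ha hz (by simp)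
    simp only [norm_div] at key
    rw [div_mul_eq_mul_div, div_le_iff₀ (hpos z hz)] at key
    simpa using key
  have hlim : Tendsto (fun ε : ℝ => ‖z - a‖ * ‖g z + ε + conj (g a + ε)‖) (𝓝[>] 0)
      (𝓝 (‖z - a‖ * ‖g z + (0 : ℝ) + conj (g a + (0 : ℝ))‖)) := by
    apply Tendsto.mono_left _ nhdsWithin_le_nhds
    have : Continuous (fun ε : ℝ => ‖z - a‖ * ‖g z + ε + conj (g a + ε)‖) := by
      fun_prop
    exact this.tendsto 0
  have := ge_of_tendsto hlim (eventually_nhdsWithin_of_forall fun ε hε => main ε hε)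
  simpa using this

open ComplexConjugate in
/-- A Harnack inequality for the full modulus of a function with nonnegative real part. -/
theorem harnack_re_nonneg {g : ℂ → ℂ} (hg : DifferentiableOn ℂ g unitDisk)
    (hre : ∀ z ∈ unitDisk, 0 ≤ (g z).re) {a z : ℂ} (ha : a ∈ unitDisk) (hz : z ∈ unitDisk) :
    ‖g z - (g a).im * Complex.I‖ ≤
      4 * (g a).re * ‖1 - conj a * z‖ ^ 2 / ((1 - ‖z‖ ^ 2) * (1 - ‖a‖ ^ 2)) := by
  have hP := mul_pos (one_sub_normSq_pos hz) (one_sub_normSq_pos ha)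
  have hid := normSq_one_sub_conj_mul_sub z a
  have hsp := schwarz_pick_re_nonneg hg hre ha hz
  have hx := hre a ha
  set D := ‖1 - conj a * z‖
  set N := ‖z - a‖
  set X := ‖g z - (g a).im * Complex.I‖
  set x := (g a).re
  have hxn : ‖(x : ℂ)‖ = x := by simp [abs_of_nonneg hx]
  have h1 : X - x ≤ ‖g z - g a‖ := by
    have := norm_sub_norm_le (g z - (g a).im * Complex.I) (x : ℂ)
    rw [hxn] at this
    refine this.trans_eq ?_
    congr 1
    apply Complex.ext <;> simp [x]
  have h2 : ‖g z + conj (g a)‖ ≤ X + x := by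
    have := norm_add_le (g z - (g a).im * Complex.I) (x : ℂ)
    rw [hxn] at this
    refine le_trans (le_of_eq ?_) this
    congr 1
    apply Complex.ext <;> simp [x, sub_eq_add_neg]
  have hN : 0 ≤ N := norm_nonneg _
  have hD : 0 ≤ D := norm_nonneg _
  have hND : N ≤ D := (norm_sub_lt_norm_one_sub_conj_mul hz ha).le
  have h3 : (X - x) * D ≤ N * (X + x) :=
    (mul_le_mul_of_nonneg_right h1 hD).trans (hsp.trans (mul_le_mul_of_nonneg_left h2 hN))
  rw [le_div_iff₀ hP, ← hid]
  have h4 : X * (D - N) ≤ x * (D + N) := by linarith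
  calc X * (D ^ 2 - N ^ 2) = X * (D - N) * (D + N) := by ring
    _ ≤ x * (D + N) * (D + N) := mul_le_mul_of_nonneg_right h4 (by positivity)
    _ ≤ x * (2 * D) * (2 * D) := by gcongr <;> linarith
    _ = 4 * x * D ^ 2 := by ring

/-- A function with nonnegative real part on the disk is either zero-free or zero. -/
theorem eq_zero_of_re_nonneg {g : ℂ → ℂ} (hg : DifferentiableOn ℂ g unitDisk)
    (hre : ∀ z ∈ unitDisk, 0 ≤ (g z).re) {a : ℂ} (ha : a ∈ unitDisk) (h0 : g a = 0) :
    ∀ z ∈ unitDisk, g z = 0 := by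
  intro z hz
  simpa [h0] using harnack_re_nonneg hg hre ha hz

open ComplexConjugate in
/-- The infinitesimal Schwarz-Pick lemma for functions with nonnegative real part. -/
theorem norm_deriv_le_of_re_nonneg {g : ℂ → ℂ} (hg : DifferentiableOn ℂ g unitDisk)
    (hre : ∀ z ∈ unitDisk, 0 ≤ (g z).re) {a : ℂ} (ha : a ∈ unitDisk) :
    ‖deriv g a‖ * (1 - ‖a‖ ^ 2) ≤ 2 * (g a).re := by
  have hd : HasDerivAt g (deriv g a) a :=
    (hg.differentiableAt (isOpen_unitDisk.mem_nhds ha)).hasDerivAt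
  have hs := hasDerivAt_iff_tendsto_slope.1 hd
  have hcont : Tendsto g (𝓝[≠] a) (𝓝 (g a)) := hd.continuousAt.tendsto.mono_left nhdsWithin_le_nhds
  have h1 : Tendsto (fun z => ‖slope g a z‖ * ‖1 - conj a * z‖) (𝓝[≠] a)
      (𝓝 (‖deriv g a‖ * ‖1 - conj a * a‖)) := by
    refine hs.norm.mul (Tendsto.mono_left ?_ nhdsWithin_le_nhds)
    have : Continuous (fun z => ‖1 - conj a * z‖) := by fun_prop
    exact this.tendsto a
  have h2 : Tendsto (fun z => ‖g z + conj (g a)‖) (𝓝[≠] a) (𝓝 ‖g a + conj (g a)‖) :=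
    (hcont.add_const _).norm
  have h3 : ‖deriv g a‖ * ‖1 - conj a * a‖ ≤ ‖g a + conj (g a)‖ := by
    refine le_of_tendsto_of_tendsto h1 h2 ?_
    filter_upwards [self_mem_nhdsWithin, nhdsWithin_le_nhds (isOpen_unitDisk.mem_nhds ha)]
      with z hza hz
    have hpos : 0 < ‖z - a‖ := norm_pos_iff.2 (sub_ne_zero.2 hza)
    have := schwarz_pick_re_nonneg hg hre ha hz
    rw [slope_def_field, norm_div, div_mul_eq_mul_div, div_le_iff₀ hpos]
    linarith
  have h4 : ‖1 - conj a * a‖ = 1 - ‖a‖ ^ 2 := by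
    rw [mul_comm, Complex.mul_conj, Complex.normSq_eq_norm_sq, ← Complex.ofReal_one,
      ← Complex.ofReal_sub, Complex.norm_real, Real.norm_of_nonneg (one_sub_normSq_pos ha).le]
  have h5 : ‖g a + conj (g a)‖ = 2 * (g a).re := by
    rw [Complex.add_conj, Complex.norm_real, Real.norm_of_nonneg]
    have := hre a ha
    positivity
  rwa [h4, h5] at h3

/-! ### Herglotz kernels and boundary point masses. -/

theorem re_herglotz_kernel {ζ : ℂ} (hζ : ‖ζ‖ = 1) (z : ℂ) :
    ((ζ + z) / (ζ - z)).re = (1 - ‖z‖ ^ 2) / ‖ζ - z‖ ^ 2 := by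
  have h1 : Complex.normSq ζ = 1 := by rw [Complex.normSq_eq_norm_sq, hζ]; norm_num
  rw [Complex.div_re, ← add_div, Complex.sq_norm, Complex.sq_norm, ← h1]
  congr 1
  simp only [Complex.normSq_apply, Complex.sub_re, Complex.sub_im, Complex.add_re, Complex.add_im]
  ring

theorem sub_ne_zero_of_mem_unitDisk {ζ z : ℂ} (hζ : ‖ζ‖ = 1) (hz : z ∈ unitDisk) :
    ζ - z ≠ 0 := by
  rintro h
  have := mem_unitDisk.1 hz
  rw [← sub_eq_zero.1 h, hζ] at this
  exact lt_irrefl _ this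

theorem differentiableOn_herglotz_kernel {ζ : ℂ} (hζ : ‖ζ‖ = 1) :
    DifferentiableOn ℂ (fun z => (ζ + z) / (ζ - z)) unitDisk :=
  DifferentiableOn.div (by fun_prop) (by fun_prop) fun _ hz => sub_ne_zero_of_mem_unitDisk hζ hz

open ComplexConjugate in
/-- A function with nonnegative real part whose real part is not bounded below by a positive
multiple of the Poisson kernel at `ζ` has no point mass at `ζ`. -/
theorem angularTendsto_mul_zero {g : ℂ → ℂ} (hg : DifferentiableOn ℂ g unitDisk)
    (hre : ∀ z ∈ unitDisk, 0 ≤ (g z).re) {ζ : ℂ} (hζ : ‖ζ‖ = 1)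
    (hinf : ∀ ε > 0, ∃ a ∈ unitDisk, (g a).re ≤ ε * ((1 - ‖a‖ ^ 2) / ‖ζ - a‖ ^ 2)) :
    AngularTendsto (fun z => (ζ - z) * g z) ζ (𝓝 0) := by
  intro M
  rw [Metric.tendsto_nhds]
  intro ε hε
  -- Harnack based at this fixed `a` bounds the product by a function continuous at `ζ` with value
  -- `4 |M| e` there; the `+ 1` makes that value strictly less than `ε`, also for `M = 0`.
  obtain ⟨a, ha, hga⟩ := hinf (ε / (4 * (|M| + 1))) (by positivity)
  set e := ε / (4 * (|M| + 1)) with he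
  have hζa : 0 < ‖ζ - a‖ := norm_pos_iff.2 (sub_ne_zero_of_mem_unitDisk hζ ha)
  have hDζ : ‖1 - conj a * ζ‖ = ‖ζ - a‖ := by
    have h := normSq_one_sub_conj_mul_sub ζ a
    rw [hζ] at h
    exact (pow_left_inj₀ (norm_nonneg _) (norm_nonneg _) two_ne_zero).1 (by linarith)
  let B : ℂ → ℝ := fun z => ‖ζ - z‖ * |(g a).im| +
    4 * |M| * e * ‖1 - conj a * z‖ ^ 2 / ‖ζ - a‖ ^ 2
  have hB : Continuous B := by fun_prop
  have hBζ : B ζ < ε := by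
    simp only [B, sub_self, norm_zero, zero_mul, zero_add, hDζ]
    rw [mul_div_assoc, div_self (by positivity), mul_one, he]
    have hM : 0 < 4 * (|M| + 1) := by positivity
    rw [mul_div_assoc', div_lt_iff₀ hM]
    nlinarith [abs_nonneg M]
  filter_upwards [self_mem_nhdsWithin,
    nhdsWithin_le_nhds ((hB.tendsto ζ).eventually (gt_mem_nhds hBζ))] with z hz hBz
  obtain ⟨hzD, hzM⟩ := hz
  rw [dist_zero_right]
  refine lt_of_le_of_lt ?_ hBz
  have hPz := one_sub_normSq_pos hzD
  have hPa := one_sub_normSq_pos ha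
  have hz1 := mem_unitDisk.1 hzD
  have hh := harnack_re_nonneg hg hre ha hzD
  have hn : ‖g z‖ ≤ |(g a).im| +
      4 * (g a).re * ‖1 - conj a * z‖ ^ 2 / ((1 - ‖z‖ ^ 2) * (1 - ‖a‖ ^ 2)) := by
    have h2 := norm_add_le ((g a).im * Complex.I : ℂ) (g z - (g a).im * Complex.I)
    rw [add_sub_cancel] at h2
    refine h2.trans (add_le_add (le_of_eq ?_) hh)
    simp
  have hst : ‖ζ - z‖ ≤ |M| * (1 - ‖z‖ ^ 2) := by
    rw [norm_sub_rev]
    calc ‖z - ζ‖ ≤ M * (1 - ‖z‖) := hzM.le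
      _ ≤ |M| * (1 - ‖z‖) := by
        apply mul_le_mul_of_nonneg_right (le_abs_self M); linarith
      _ ≤ |M| * (1 - ‖z‖ ^ 2) := by
        apply mul_le_mul_of_nonneg_left _ (abs_nonneg M)
        nlinarith [norm_nonneg z]
  have hga0 := hre a ha
  calc ‖(ζ - z) * g z‖ = ‖ζ - z‖ * ‖g z‖ := norm_mul _ _
    _ ≤ ‖ζ - z‖ * (|(g a).im| +
      4 * (g a).re * ‖1 - conj a * z‖ ^ 2 / ((1 - ‖z‖ ^ 2) * (1 - ‖a‖ ^ 2))) := by gcongr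
    _ = ‖ζ - z‖ * |(g a).im| + ‖ζ - z‖ * (4 * (g a).re * ‖1 - conj a * z‖ ^ 2
        / ((1 - ‖z‖ ^ 2) * (1 - ‖a‖ ^ 2))) := by ring
    _ ≤ ‖ζ - z‖ * |(g a).im| + (|M| * (1 - ‖z‖ ^ 2)) *
        (4 * (e * ((1 - ‖a‖ ^ 2) / ‖ζ - a‖ ^ 2)) * ‖1 - conj a * z‖ ^ 2
        / ((1 - ‖z‖ ^ 2) * (1 - ‖a‖ ^ 2))) := by gcongr
    _ = B z := by
      simp only [B]
      have h1 := hPz.ne'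
      have h2 := hPa.ne'
      have h3 := hζa.ne'
      generalize 1 - ‖z‖ ^ 2 = u at *
      generalize 1 - ‖a‖ ^ 2 = v at *
      field_simp

/-- The Julia-Wolff-Carathéodory theorem for functions with nonnegative real part: existence of
the point mass of the Herglotz measure at `ζ`. -/
theorem exists_point_mass {g : ℂ → ℂ} (hg : DifferentiableOn ℂ g unitDisk)
    (hre : ∀ z ∈ unitDisk, 0 ≤ (g z).re) {ζ : ℂ} (hζ : ‖ζ‖ = 1) :
    ∃ c : ℝ, 0 ≤ c ∧ (∀ z ∈ unitDisk, 0 ≤ (g z - c * ((ζ + z) / (ζ - z))).re) ∧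
      AngularTendsto (fun z => (ζ - z) * g z) ζ (𝓝 (2 * c * ζ)) := by
  have hKpos : ∀ z ∈ unitDisk, 0 < (1 - ‖z‖ ^ 2) / ‖ζ - z‖ ^ 2 := fun z hz =>
    div_pos (one_sub_normSq_pos hz)
      (pow_pos (norm_pos_iff.2 (sub_ne_zero_of_mem_unitDisk hζ hz)) 2)
  set S := (fun z => (g z).re / ((1 - ‖z‖ ^ 2) / ‖ζ - z‖ ^ 2)) '' unitDisk with hS
  have hS0 : ∀ x ∈ S, 0 ≤ x := by
    rintro x ⟨z, hz, rfl⟩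
    exact div_nonneg (hre z hz) (hKpos z hz).le
  have hSne : S.Nonempty := ⟨_, 0, mem_unitDisk.2 (by simp), rfl⟩
  -- The largest `c` for which subtracting `c` times the kernel preserves nonnegativity; its
  -- maximality supplies the hypothesis of `angularTendsto_mul_zero`.
  set c := sInf S with hc
  have hre1 : ∀ z, (g z - c * ((ζ + z) / (ζ - z))).re
      = (g z).re - c * ((1 - ‖z‖ ^ 2) / ‖ζ - z‖ ^ 2) := fun z => by
    rw [Complex.sub_re, Complex.re_ofReal_mul, re_herglotz_kernel hζ]
  have hle : ∀ z ∈ unitDisk, 0 ≤ (g z - c * ((ζ + z) / (ζ - z))).re := by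
    intro z hz
    have h1 : c ≤ (g z).re / ((1 - ‖z‖ ^ 2) / ‖ζ - z‖ ^ 2) :=
      csInf_le ⟨0, hS0⟩ ⟨z, hz, rfl⟩
    rw [le_div_iff₀ (hKpos z hz)] at h1
    rw [hre1]; linarith
  refine ⟨c, Real.sInf_nonneg hS0, hle, ?_⟩
  have hzero := angularTendsto_mul_zero (g := fun z => g z - c * ((ζ + z) / (ζ - z)))
    (hg.sub ((differentiableOn_herglotz_kernel hζ).const_mul _)) hle hζ (by
      intro ε hε
      obtain ⟨_, ⟨a, ha, rfl⟩, hlt⟩ := exists_lt_of_csInf_lt hSne (lt_add_of_pos_right c hε)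
      refine ⟨a, ha, ?_⟩
      simp only at hlt
      rw [div_lt_iff₀ (hKpos a ha)] at hlt
      rw [hre1]; linarith)
  intro M
  have h2 : Tendsto (fun z => c * (ζ + z)) (𝓝[stolzRegion ζ M] ζ) (𝓝 (c * (ζ + ζ))) := by
    apply Tendsto.mono_left _ nhdsWithin_le_nhds
    have : Continuous (fun z => c * (ζ + z)) := by fun_prop
    exact this.tendsto ζ
  have h3 := (hzero M).add h2
  rw [show (0 : ℂ) + c * (ζ + ζ) = 2 * c * ζ by ring] at h3
  refine h3.congr' ?_
  filter_upwards [self_mem_nhdsWithin] with z hz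
  have := sub_ne_zero_of_mem_unitDisk hζ hz.1
  field_simp
  ring

/-! ### Berkson–Porta, necessity, and absence of zeros. -/

/-- A holomorphic self-map of the disk with an orbit converging to `1` maps every horodisk
at `1` into itself. -/
theorem horodisk_le_of_orbit {G : ℂ → ℂ} (hG : DifferentiableOn ℂ G unitDisk)
    (hmaps : Set.MapsTo G unitDisk unitDisk) {a : ℕ → ℂ} (ha : ∀ n, a n ∈ unitDisk)
    (hstep : ∀ n, a (n + 1) = G (a n)) (hlim : Tendsto a atTop (𝓝 1)) {z : ℂ}
    (hz : z ∈ unitDisk) :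
    (1 - ‖z‖ ^ 2) / ‖1 - z‖ ^ 2 ≤ (1 - ‖G z‖ ^ 2) / ‖1 - G z‖ ^ 2 := by
  -- Schwarz–Pick between `z` and `a n`, squared and rewritten by `normSq_one_sub_conj_mul_sub`.
  have h1 : ∀ n, (1 - ‖z‖ ^ 2) * (1 - ‖a n‖ ^ 2) * ‖1 - (starRingEnd ℂ) (a (n + 1)) * G z‖ ^ 2 ≤
      (1 - ‖G z‖ ^ 2) * (1 - ‖a (n + 1)‖ ^ 2) * ‖1 - (starRingEnd ℂ) (a n) * z‖ ^ 2 := by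
    intro n
    have h := schwarz_pick hG hmaps (ha n) hz
    rw [← hstep] at h
    have h' := pow_le_pow_left₀ (by positivity) h 2
    rw [mul_pow, mul_pow] at h'
    have i1 := normSq_one_sub_conj_mul_sub z (a n)
    have i2 := normSq_one_sub_conj_mul_sub (G z) (a (n + 1))
    rw [← i1, ← i2]
    nlinarith
  -- The positive numbers `1 - ‖a n‖ ^ 2` tend to `0`, so they cannot be eventually increasing.
  -- Infinitely many good indices suffice for passing to the limit.
  have hfreq : ∃ᶠ n in atTop, 1 - ‖a (n + 1)‖ ^ 2 ≤ 1 - ‖a n‖ ^ 2 := by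
    intro hev
    obtain ⟨N, hN⟩ := eventually_atTop.1 hev
    have hmono : ∀ n ≥ N, 1 - ‖a N‖ ^ 2 ≤ 1 - ‖a n‖ ^ 2 := by
      intro n hn
      induction n, hn using Nat.le_induction with
      | base => exact le_rfl
      | succ n hn ih => exact ih.trans (not_le.1 (hN n hn)).le
    have hl : Tendsto (fun n => 1 - ‖a n‖ ^ 2) atTop (𝓝 (1 - ‖(1 : ℂ)‖ ^ 2)) :=
      (hlim.norm.pow 2).const_sub 1
    have := ge_of_tendsto hl (eventually_atTop.2 ⟨N, hmono⟩)
    have h0 := one_sub_normSq_pos (ha N)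
    simp only [norm_one] at this
    linarith
  have hc : ∀ w : ℂ, Tendsto (fun n => ‖1 - (starRingEnd ℂ) (a n) * w‖ ^ 2) atTop
      (𝓝 (‖1 - w‖ ^ 2)) := by
    intro w
    have : Continuous fun u : ℂ => ‖1 - (starRingEnd ℂ) u * w‖ ^ 2 := by fun_prop
    simpa [Function.comp_def] using (this.tendsto 1).comp hlim
  have hfin : (1 - ‖z‖ ^ 2) * ‖1 - G z‖ ^ 2 ≤ (1 - ‖G z‖ ^ 2) * ‖1 - z‖ ^ 2 := by
    refine le_of_tendsto_of_tendsto_of_frequently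
      (((hc (G z)).comp (tendsto_add_atTop_nat 1)).const_mul _) ((hc z).const_mul _) ?_
    refine hfreq.mono fun n hn => ?_
    have p1 := one_sub_normSq_pos (ha n)
    have p2 := one_sub_normSq_pos (hmaps hz)
    have := h1 n
    simp only [Function.comp_apply]
    refine le_of_mul_le_mul_right ?_ p1
    calc _ = (1 - ‖z‖ ^ 2) * (1 - ‖a n‖ ^ 2) * ‖1 - (starRingEnd ℂ) (a (n + 1)) * G z‖ ^ 2 := by
          ring
      _ ≤ _ := h1 n
      _ ≤ (1 - ‖G z‖ ^ 2) * (1 - ‖a n‖ ^ 2) * ‖1 - (starRingEnd ℂ) (a n) * z‖ ^ 2 := by gcongr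
      _ = _ := by ring
  have q1 : 0 < ‖1 - z‖ := norm_pos_iff.2 (sub_ne_zero_of_mem_unitDisk norm_one hz)
  have q2 : 0 < ‖1 - G z‖ := norm_pos_iff.2 (sub_ne_zero_of_mem_unitDisk norm_one (hmaps hz))
  rw [div_le_div_iff₀ (by positivity) (by positivity)]
  exact hfin

theorem IsGeneratorOf.tendsto_zero {f : ℂ → ℂ} {F : ℝ → ℂ → ℂ} (hf : IsGeneratorOf f F) {z : ℂ}
    (hz : z ∈ unitDisk) : Tendsto (fun t => F t z) (𝓝[>] 0) (𝓝 z) := by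
  have h1 : Tendsto (fun t : ℝ => (t : ℂ)) (𝓝[>] 0) (𝓝 0) := by
    apply Tendsto.mono_left _ nhdsWithin_le_nhds
    exact Complex.continuous_ofReal.tendsto' 0 0 (by simp)
  have h2 := (h1.mul (hf.2 z hz)).const_sub z
  simp only [zero_mul, sub_zero] at h2
  refine h2.congr' ?_
  filter_upwards [self_mem_nhdsWithin] with t ht
  have : (t : ℂ) ≠ 0 := by exact_mod_cast (ne_of_gt ht)
  field_simp
  ring

/-- The necessity part of the Berkson-Porta formula for the Denjoy-Wolff point `1`. -/
theorem re_berkson_porta_nonneg {f : ℂ → ℂ} {F : ℝ → ℂ → ℂ} (hF : IsHolomorphicSemigroup F)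
    (hf : IsGeneratorOf f F) (hDW : IsDenjoyWolffPoint F 1) {z : ℂ} (hz : z ∈ unitDisk) :
    0 ≤ (-f z / (1 - z) ^ 2).re := by
  have h0 : (0 : ℂ) ∈ unitDisk := mem_unitDisk.2 (by simp)
  have hhoro : ∀ t > 0, ((1 + z) / (1 - z)).re ≤ ((1 + F t z) / (1 - F t z)).re := by
    intro t ht
    rw [re_herglotz_kernel norm_one, re_herglotz_kernel norm_one]
    refine horodisk_le_of_orbit (a := fun n : ℕ => F (n * t) 0) (hF.differentiableOn t ht.le)
      (hF.mapsTo t ht.le) (fun n => hF.mapsTo _ (by positivity) h0) (fun n => ?_) ?_ hz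
    · rw [← hF.map_add t (n * t) ht.le (by positivity) 0 h0]
      congr 1
      push_cast
      ring
    · exact (hDW 0 h0).comp (tendsto_natCast_atTop_atTop.atTop_mul_const ht)
  have hz1 := sub_ne_zero_of_mem_unitDisk norm_one hz
  -- The map `z ↦ (1 + z)/(1 - z)` has derivative `2/(1 - z)²`, whence the division by `2`.
  have hlim : Tendsto (fun t : ℝ => ((1 + F t z) / (1 - F t z) - (1 + z) / (1 - z)) / t / 2)
      (𝓝[>] 0) (𝓝 (-f z / (1 - z) ^ 2)) := by
    have h1 : Tendsto (fun t : ℝ => -((z - F t z) / t) / ((1 - F t z) * (1 - z))) (𝓝[>] 0)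
        (𝓝 (-f z / ((1 - z) * (1 - z)))) :=
      (hf.2 z hz).neg.div (((hf.tendsto_zero hz).const_sub 1).mul_const _) (mul_ne_zero hz1 hz1)
    rw [← pow_two] at h1
    refine h1.congr' ?_
    filter_upwards [self_mem_nhdsWithin] with t ht
    have h2 := sub_ne_zero_of_mem_unitDisk norm_one (hF.mapsTo t (le_of_lt ht) hz)
    have : (t : ℂ) ≠ 0 := by exact_mod_cast (ne_of_gt ht)
    field_simp
    ring
  refine ge_of_tendsto ((Complex.continuous_re.tendsto _).comp hlim) ?_
  filter_upwards [self_mem_nhdsWithin] with t ht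
  have := hhoro t ht
  have ht0 : (0 : ℝ) < t := ht
  simp only [Function.comp_apply]
  rw [show (2 : ℂ) = ((2 : ℝ) : ℂ) by norm_num, Complex.div_ofReal_re, Complex.div_ofReal_re,
    Complex.sub_re]
  have := sub_nonneg.2 this
  positivity

/-- A zero of the generator in the disk is a fixed point of the semigroup. -/
theorem fixed_of_generator_eq_zero {f : ℂ → ℂ} {F : ℝ → ℂ → ℂ} (hF : IsHolomorphicSemigroup F)
    (hf : IsGeneratorOf f F) {z : ℂ} (hz : z ∈ unitDisk) (h0 : f z = 0) {T : ℝ} (hT : 0 < T) :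
    F T z = z := by
  have hz1 : 0 < 1 - ‖z‖ := sub_pos.2 (mem_unitDisk.1 hz)
  have hstep : ∀ s ≥ 0, ∀ t ≥ 0, ‖F (s + t) z - F s z‖ ≤ 2 / (1 - ‖z‖) * ‖F t z - z‖ := by
    intro s hs t ht
    have hw := hF.mapsTo t ht hz
    rw [hF.map_add s t hs ht z hz]
    have h := schwarz_pick (hF.differentiableOn s hs) (hF.mapsTo s hs) hz hw
    have h1 : ‖1 - (starRingEnd ℂ) (F s z) * F s (F t z)‖ ≤ 2 := by
      refine (norm_sub_le _ _).trans ?_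
      rw [norm_mul, RCLike.norm_conj, norm_one]
      have a1 := mem_unitDisk.1 (hF.mapsTo s hs hz)
      have a2 := mem_unitDisk.1 (hF.mapsTo s hs hw)
      nlinarith [norm_nonneg (F s z), norm_nonneg (F s (F t z))]
    have h2 : 1 - ‖z‖ ≤ ‖1 - (starRingEnd ℂ) z * F t z‖ := by
      have := norm_sub_norm_le (1 : ℂ) ((starRingEnd ℂ) z * F t z)
      rw [norm_mul, RCLike.norm_conj, norm_one] at this
      have a2 := mem_unitDisk.1 hw
      nlinarith [norm_nonneg z]
    rw [div_mul_eq_mul_div, le_div_iff₀ hz1]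
    calc _ ≤ ‖F s (F t z) - F s z‖ * ‖1 - (starRingEnd ℂ) z * F t z‖ := by gcongr
      _ ≤ _ := h
      _ ≤ ‖F t z - z‖ * 2 := by gcongr
      _ = _ := by ring
  -- The orbit over `[0, T]` is cut into `n + 1` equal pieces, each controlled by the first through
  -- `hstep`; the total is a constant times a difference quotient tending to `‖f z‖ = 0`.
  have hbound : ∀ n : ℕ, ‖F T z - z‖ ≤
      T * (2 / (1 - ‖z‖)) * ‖(z - F (T / (n + 1 : ℕ)) z) / ((T / (n + 1 : ℕ) : ℝ) : ℂ)‖ := by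
    intro n
    have hτ : 0 < T / (n + 1 : ℕ) := by positivity
    set τ := T / (n + 1 : ℕ) with hτd
    have h := dist_le_range_sum_dist (fun k : ℕ => F (k * τ) z) (n + 1)
    have hn : ((n + 1 : ℕ) : ℝ) * τ = T := by rw [hτd]; field_simp
    simp only [hn, Nat.cast_zero, zero_mul, hF.map_zero z hz] at h
    rw [dist_comm, dist_eq_norm] at h
    refine h.trans ?_
    have h2 : ∀ k ∈ Finset.range (n + 1), dist (F (k * τ) z) (F ((k + 1 : ℕ) * τ) z)
        ≤ 2 / (1 - ‖z‖) * ‖F τ z - z‖ := by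
      intro k _
      rw [dist_comm, dist_eq_norm]
      have := hstep (k * τ) (by positivity) τ hτ.le
      rwa [show (k : ℝ) * τ + τ = ((k + 1 : ℕ) : ℝ) * τ by push_cast; ring] at this
    refine (Finset.sum_le_card_nsmul _ _ _ h2).trans (le_of_eq ?_)
    rw [Finset.card_range, nsmul_eq_mul, norm_div, norm_sub_rev, Complex.norm_real,
      Real.norm_of_nonneg hτ.le, ← hn]
    field_simp
  have hlim : Tendsto (fun n : ℕ => T / ((n + 1 : ℕ) : ℝ)) atTop (𝓝[>] 0) := by
    refine tendsto_nhdsWithin_iff.2 ⟨?_, Eventually.of_forall fun n => ?_⟩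
    · exact (tendsto_const_div_atTop_nhds_zero_nat T).comp (tendsto_add_atTop_nat 1)
    · exact div_pos hT (by positivity)
  have hl := (((hf.2 z hz).comp hlim).norm).const_mul (T * (2 / (1 - ‖z‖)))
  rw [h0, norm_zero, mul_zero] at hl
  have := ge_of_tendsto hl (Eventually.of_forall hbound)
  exact sub_eq_zero.1 (norm_le_zero_iff.1 this)

theorem generator_ne_zero {f : ℂ → ℂ} {F : ℝ → ℂ → ℂ} (hF : IsHolomorphicSemigroup F)
    (hf : IsGeneratorOf f F) (hDW : IsDenjoyWolffPoint F 1) {z : ℂ} (hz : z ∈ unitDisk) :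
    f z ≠ 0 := by
  intro h0
  have h1 : Tendsto (fun t : ℝ => F t z) atTop (𝓝 z) := by
    refine tendsto_const_nhds.congr' ?_
    filter_upwards [eventually_gt_atTop 0] with t ht
    exact (fixed_of_generator_eq_zero hF hf hz h0 ht).symm
  have h2 := tendsto_nhds_unique h1 (hDW z hz)
  exact sub_ne_zero_of_mem_unitDisk norm_one hz (by rw [h2, sub_self])

/-! ### Linearization on the right half-plane. -/

/-- The open right half-plane. -/
def rightHalfPlane : Set ℂ := {w | 0 < w.re}

theorem isOpen_rightHalfPlane : IsOpen rightHalfPlane :=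
  isOpen_lt continuous_const Complex.continuous_re

/-- The Noshiro-Warschawski criterion on the right half-plane. -/
theorem injOn_of_re_mul_deriv_pos {S Q : ℂ → ℂ} (hS : ∀ w ∈ rightHalfPlane, HasDerivAt S (Q w) w)
    {c : ℂ} (hc : ∀ w ∈ rightHalfPlane, 0 < (c * Q w).re) : Set.InjOn S rightHalfPlane := by
  intro a ha b hb hab
  by_contra hne
  have hba : b - a ≠ 0 := sub_ne_zero.2 (Ne.symm hne)
  have hseg : ∀ s ∈ Set.Icc (0 : ℝ) 1, a + s * (b - a) ∈ rightHalfPlane := by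
    rintro s ⟨h0, h1⟩
    have ha' : 0 < a.re := ha
    have hb' : 0 < b.re := hb
    have : (a + s * (b - a)).re = (1 - s) * a.re + s * b.re := by
      simp only [Complex.add_re, Complex.re_ofReal_mul, Complex.sub_re]; ring
    change 0 < (a + s * (b - a)).re
    rw [this]
    rcases eq_or_lt_of_le h0 with rfl | h0
    · simpa using ha'
    · have := mul_nonneg (sub_nonneg.2 h1) ha'.le
      have := mul_pos h0 hb'
      linarith
  have hder : ∀ s ∈ Set.Icc (0 : ℝ) 1,
      HasDerivAt (fun s : ℝ => (c * S (a + s * (b - a)) / (b - a)).re)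
        (c * Q (a + s * (b - a))).re s := by
    intro s hs
    have h1 : HasDerivAt (fun s : ℝ => a + (s : ℂ) * (b - a)) (1 * (b - a)) s :=
      ((Complex.ofRealCLM.hasDerivAt (x := s)).mul_const (b - a)).const_add a
    have h2 := (((hS _ (hseg s hs)).comp s h1).const_mul c).div_const (b - a)
    have h3 := Complex.reCLM.hasFDerivAt.comp_hasDerivAt s h2
    refine h3.congr_deriv ?_
    rw [Complex.reCLM_apply]
    congr 1
    field_simp
  have hmono : StrictMonoOn (fun s : ℝ => (c * S (a + s * (b - a)) / (b - a)).re)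
      (Set.Icc 0 1) := by
    refine strictMonoOn_of_deriv_pos (convex_Icc 0 1)
      (fun s hs => (hder s hs).continuousAt.continuousWithinAt) fun s hs => ?_
    have hs' := interior_subset hs
    rw [(hder s hs').deriv]
    exact hc _ (hseg s hs')
  have := hmono (Set.left_mem_Icc.2 zero_le_one) (Set.right_mem_Icc.2 zero_le_one) zero_lt_one
  simp [hab] at this

section Inverse

variable {S P : ℂ → ℂ} (hS : ∀ w ∈ rightHalfPlane, HasDerivAt S (P w)⁻¹ w)
  (hP0 : ∀ w ∈ rightHalfPlane, P w ≠ 0) (hinj : Set.InjOn S rightHalfPlane)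

-- Nonvanishing of `P` is needed because `0⁻¹ = 0`: it ensures that the derivative of `S` is never
-- zero, so `S` is locally open.
include hS hP0 in
theorem map_nhds_of_hasDerivAt_inv {w : ℂ} (hw : w ∈ rightHalfPlane) :
    map S (𝓝 w) = 𝓝 (S w) := by
  have hd : DifferentiableOn ℂ S rightHalfPlane := fun v hv =>
    (hS v hv).differentiableAt.differentiableWithinAt
  have h1 := (hd.analyticAt (isOpen_rightHalfPlane.mem_nhds hw)).hasStrictDerivAt
  rw [(hS w hw).deriv] at h1
  exact h1.map_nhds_eq (inv_ne_zero (hP0 w hw))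

include hS hP0 in
theorem isOpen_image_of_hasDerivAt_inv : IsOpen (S '' rightHalfPlane) := by
  rw [isOpen_iff_mem_nhds]
  rintro _ ⟨w, hw, rfl⟩
  rw [← map_nhds_of_hasDerivAt_inv hS hP0 hw]
  exact image_mem_map (isOpen_rightHalfPlane.mem_nhds hw)

include hS hP0 hinj in
theorem hasDerivAt_invFunOn {w : ℂ} (hw : w ∈ rightHalfPlane) :
    HasDerivAt (Function.invFunOn S rightHalfPlane) (P w) (S w) := by
  have hleft := hinj.leftInvOn_invFunOn
  have hcont : ContinuousAt (Function.invFunOn S rightHalfPlane) (S w) := by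
    rw [ContinuousAt, hleft hw, ← map_nhds_of_hasDerivAt_inv hS hP0 hw, tendsto_map'_iff]
    refine tendsto_id.congr' ?_
    filter_upwards [isOpen_rightHalfPlane.mem_nhds hw] with v hv
    exact (hleft hv).symm
  have hd : HasDerivAt S (P w)⁻¹ (Function.invFunOn S rightHalfPlane (S w)) := by
    rw [hleft hw]; exact hS w hw
  have := HasDerivAt.of_local_left_inverse hcont hd (inv_ne_zero (hP0 w hw)) (by
    filter_upwards [(isOpen_image_of_hasDerivAt_inv hS hP0).mem_nhds ⟨w, hw, rfl⟩] with y hy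
    exact Function.invFunOn_eq hy)
  rwa [inv_inv] at this

end Inverse

/-- If `w' = P(w)` on `[0, T)` in the right half-plane, where `Re P ≥ 0` and `P` satisfies the
infinitesimal Schwarz-Pick inequality, then the trajectory stays in a compact subset. -/
theorem trajectory_bounded {P P' : ℂ → ℂ} {w : ℝ → ℂ} {T : ℝ}
    (hPd : ∀ v ∈ rightHalfPlane, HasDerivAt P (P' v) v)
    (hPb : ∀ v ∈ rightHalfPlane, ‖P' v‖ * v.re ≤ (P v).re)
    (hw : ∀ t ∈ Set.Ico 0 T, w t ∈ rightHalfPlane)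
    (hd : ∀ t ∈ Set.Ico 0 T, HasDerivAt w (P (w t)) t) :
    ∃ R : ℝ, ∀ t ∈ Set.Ico 0 T, (w 0).re ≤ (w t).re ∧ ‖w t - w 0‖ ≤ R := by
  rcases le_or_gt T 0 with hT | hT
  · exact ⟨0, fun t ht => absurd (ht.1.trans_lt ht.2) (not_lt.2 hT)⟩
  have h0 : (0 : ℝ) ∈ Set.Ico 0 T := ⟨le_rfl, hT⟩
  have hx : ∀ t ∈ Set.Ico 0 T, HasDerivAt (fun t => (w t).re) (P (w t)).re t := fun t ht =>
    Complex.reCLM.hasFDerivAt.comp_hasDerivAt t (hd t ht)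
  have hpos : ∀ t ∈ Set.Ico 0 T, 0 < (w t).re := hw
  have hPre : ∀ v ∈ rightHalfPlane, 0 ≤ (P v).re := fun v hv =>
    (mul_nonneg (norm_nonneg _) (le_of_lt hv)).trans (hPb v hv)
  have hmono : MonotoneOn (fun t => (w t).re) (Set.Ico 0 T) := by
    refine monotoneOn_of_deriv_nonneg (convex_Ico 0 T)
      (fun t ht => (hx t ht).continuousAt.continuousWithinAt)
      (fun t ht => (hx t (interior_subset ht)).differentiableAt.differentiableWithinAt)
      fun t ht => ?_
    rw [(hx t (interior_subset ht)).deriv]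
    exact hPre _ (hw t (interior_subset ht))
  -- The square of the hyperbolic speed of the trajectory. It is nonincreasing because `hPb` is the
  -- infinitesimal form of hyperbolic contraction.
  have hu : ∀ t ∈ Set.Ico 0 T, HasDerivAt (fun t => ‖P (w t)‖ ^ 2 / (w t).re ^ 2)
      ((2 * inner ℝ (P (w t)) (P' (w t) * P (w t)) * (w t).re ^ 2 -
        ‖P (w t)‖ ^ 2 * (2 * (w t).re * (P (w t)).re)) / ((w t).re ^ 2) ^ 2) t := by
    intro t ht
    have h1 : HasDerivAt (fun t => P (w t)) (P' (w t) * P (w t)) t :=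
      (hPd _ (hw t ht)).comp t (hd t ht)
    have h2 := h1.norm_sq.div ((hx t ht).pow 2) (pow_ne_zero 2 (hpos t ht).ne')
    refine h2.congr_deriv ?_
    simp
  have hanti : AntitoneOn (fun t => ‖P (w t)‖ ^ 2 / (w t).re ^ 2) (Set.Ico 0 T) := by
    refine antitoneOn_of_deriv_nonpos (convex_Ico 0 T)
      (fun t ht => (hu t ht).continuousAt.continuousWithinAt)
      (fun t ht => (hu t (interior_subset ht)).differentiableAt.differentiableWithinAt)
      fun t ht => ?_
    have ht' := interior_subset ht
    rw [(hu t ht').deriv]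
    refine div_nonpos_of_nonpos_of_nonneg ?_ (by positivity)
    have h1 := real_inner_le_norm (P (w t)) (P' (w t) * P (w t))
    have h2 := hPb _ (hw t ht')
    have hp := hpos t ht'
    rw [norm_mul] at h1
    have h3 : inner ℝ (P (w t)) (P' (w t) * P (w t)) * (w t).re ≤
        ‖P (w t)‖ ^ 2 * (P (w t)).re := by
      calc _ ≤ ‖P (w t)‖ * (‖P' (w t)‖ * ‖P (w t)‖) * (w t).re := by gcongr
        _ = ‖P (w t)‖ ^ 2 * (‖P' (w t)‖ * (w t).re) := by ring
        _ ≤ _ := by gcongr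
    nlinarith [mul_le_mul_of_nonneg_right h3 hp.le]
  set K := ‖P (w 0)‖ / (w 0).re with hK
  have hK0 : 0 ≤ K := div_nonneg (norm_nonneg _) (hpos 0 h0).le
  have hspeed : ∀ t ∈ Set.Ico 0 T, ‖P (w t)‖ ≤ K * (w t).re := by
    intro t ht
    have h1 := hanti h0 ht ht.1
    simp only at h1
    rw [← div_pow, ← div_pow, ← hK] at h1
    have h2 := (pow_le_pow_iff_left₀ (div_nonneg (norm_nonneg _) (hpos t ht).le) hK0
      two_ne_zero).1 h1
    rwa [div_le_iff₀ (hpos t ht)] at h2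
  -- Grönwall: bounded hyperbolic speed allows at most exponential growth of the real part.
  have hv : ∀ t ∈ Set.Ico 0 T, HasDerivAt (fun t => (w t).re * Real.exp (-(K * t)))
      ((P (w t)).re * Real.exp (-(K * t)) + (w t).re * (Real.exp (-(K * t)) * -(K * 1))) t :=
    fun t ht => (hx t ht).mul ((((hasDerivAt_id t).const_mul K).neg).exp)
  have hvanti : AntitoneOn (fun t => (w t).re * Real.exp (-(K * t))) (Set.Ico 0 T) := by
    refine antitoneOn_of_deriv_nonpos (convex_Ico 0 T)
      (fun t ht => (hv t ht).continuousAt.continuousWithinAt)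
      (fun t ht => (hv t (interior_subset ht)).differentiableAt.differentiableWithinAt)
      fun t ht => ?_
    have ht' := interior_subset ht
    rw [(hv t ht').deriv]
    have h1 := (Complex.re_le_norm _).trans (hspeed t ht')
    nlinarith [Real.exp_pos (-(K * t))]
  have hgrow : ∀ t ∈ Set.Ico 0 T, (w t).re ≤ (w 0).re * Real.exp (K * T) := by
    intro t ht
    have h1 := hvanti h0 ht ht.1
    simp only [mul_zero, neg_zero, Real.exp_zero, mul_one, Real.exp_neg] at h1
    rw [mul_inv_le_iff₀ (Real.exp_pos _)] at h1
    refine h1.trans (mul_le_mul_of_nonneg_left (Real.exp_le_exp.2 ?_) (hpos 0 h0).le)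
    exact mul_le_mul_of_nonneg_left ht.2.le hK0
  set L := K * ((w 0).re * Real.exp (K * T)) with hL
  have hL0 : 0 ≤ L := mul_nonneg hK0 (mul_nonneg (hpos 0 h0).le (Real.exp_pos _).le)
  refine ⟨L * T, fun t ht => ⟨hmono h0 ht ht.1, ?_⟩⟩
  have h1 := (convex_Ico 0 T).norm_image_sub_le_of_norm_hasDerivWithin_le
    (fun s hs => (hd s hs).hasDerivWithinAt) (fun s hs => (hspeed s hs).trans
      (mul_le_mul_of_nonneg_left (hgrow s hs) hK0)) h0 ht
  refine h1.trans ?_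
  rw [sub_zero, Real.norm_of_nonneg ht.1]
  exact mul_le_mul_of_nonneg_left ht.2.le hL0

/-- The image of the linearizing map is invariant under translations to the right. -/
theorem add_ofReal_mem_image {S P P' : ℂ → ℂ}
    (hS : ∀ w ∈ rightHalfPlane, HasDerivAt S (P w)⁻¹ w)
    (hP0 : ∀ w ∈ rightHalfPlane, P w ≠ 0) (hinj : Set.InjOn S rightHalfPlane)
    (hPd : ∀ v ∈ rightHalfPlane, HasDerivAt P (P' v) v)
    (hPb : ∀ v ∈ rightHalfPlane, ‖P' v‖ * v.re ≤ (P v).re)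
    {a : ℂ} (ha : a ∈ rightHalfPlane) {t : ℝ} (ht : 0 ≤ t) :
    S a + t ∈ S '' rightHalfPlane := by
  by_contra hcon
  have hshift : Continuous fun s : ℝ => S a + (s : ℂ) := by fun_prop
  -- The times outside the image form a closed set, so there is a first exit time `T`, positive
  -- because the image contains `S a`.
  set B : Set ℝ := Set.Ici 0 ∩ (fun s : ℝ => S a + (s : ℂ)) ⁻¹' (S '' rightHalfPlane)ᶜ with hB
  have hBc : IsClosed B := isClosed_Ici.inter
    ((isOpen_image_of_hasDerivAt_inv hS hP0).isClosed_compl.preimage hshift)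
  have hBbdd : BddBelow B := ⟨0, fun s hs => hs.1⟩
  have hTB : sInf B ∈ B := hBc.csInf_mem ⟨t, ht, hcon⟩ hBbdd
  set T := sInf B with hT
  have hTpos : 0 < T := by
    refine lt_of_le_of_ne hTB.1 fun h => ?_
    refine hTB.2 ?_
    rw [← h]
    exact ⟨a, ha, by simp⟩
  have hin : ∀ s ∈ Set.Ico 0 T, S a + (s : ℂ) ∈ S '' rightHalfPlane := by
    intro s hs
    by_contra h
    exact notMem_of_lt_csInf hs.2 hBbdd ⟨hs.1, h⟩
  set ψ := Function.invFunOn S rightHalfPlane with hψ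
  have hw : ∀ s ∈ Set.Ico 0 T, ψ (S a + (s : ℂ)) ∈ rightHalfPlane := fun s hs =>
    Function.invFunOn_mem (hin s hs)
  have hSw : ∀ s ∈ Set.Ico 0 T, S (ψ (S a + (s : ℂ))) = S a + (s : ℂ) := fun s hs =>
    Function.invFunOn_eq (hin s hs)
  have hd : ∀ s ∈ Set.Ico 0 T,
      HasDerivAt (fun s : ℝ => ψ (S a + (s : ℂ))) (P (ψ (S a + (s : ℂ)))) s := by
    intro s hs
    have h1 := hasDerivAt_invFunOn hS hP0 hinj (hw s hs)
    rw [hSw s hs] at h1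
    have h2 : HasDerivAt (fun s : ℝ => S a + (s : ℂ)) 1 s :=
      (Complex.ofRealCLM.hasDerivAt (x := s)).const_add (S a)
    exact (h1.comp s h2).congr_deriv (mul_one _)
  obtain ⟨R, hR⟩ := trajectory_bounded hPd hPb hw hd
  have hψ0 : ψ (S a + ((0 : ℝ) : ℂ)) = a := by
    rw [Complex.ofReal_zero, add_zero]
    exact hinj.leftInvOn_invFunOn ha
  rw [hψ0] at hR
  -- The trajectory before time `T` stays in this compact set, whose closed image must contain the
  -- limit point; this contradicts exit at `T`.
  set C : Set ℂ := Metric.closedBall a R ∩ {v | a.re ≤ v.re} with hC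
  have hCsub : C ⊆ rightHalfPlane := fun v hv => lt_of_lt_of_le (show 0 < a.re from ha) hv.2
  have hCcomp : IsCompact C := (isCompact_closedBall a R).inter_right
    (isClosed_le continuous_const Complex.continuous_re)
  have hSC : IsClosed (S '' C) := (hCcomp.image_of_continuousOn fun v hv =>
    (hS v (hCsub hv)).continuousAt.continuousWithinAt).isClosed
  have hlim : Tendsto (fun s : ℝ => S a + (s : ℂ)) (𝓝[<] T) (𝓝 (S a + (T : ℂ))) :=
    (hshift.tendsto T).mono_left nhdsWithin_le_nhds
  have hmem : S a + (T : ℂ) ∈ S '' C := by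
    refine hSC.mem_of_tendsto hlim ?_
    filter_upwards [Ico_mem_nhdsLT hTpos] with s hs
    obtain ⟨h1, h2⟩ := hR s hs
    exact ⟨_, ⟨by simpa [dist_eq_norm] using h2, h1⟩, hSw s hs⟩
  exact hTB.2 (Set.image_mono hCsub hmem)

/-! ### Cayley transform and Berkson–Porta, sufficiency. -/

theorem cayley_add_one_ne_zero {w : ℂ} (hw : w ∈ rightHalfPlane) : w + 1 ≠ 0 := by
  intro h
  have h1 := congrArg Complex.re h
  have h2 : 0 < w.re := hw
  simp only [Complex.add_re, Complex.one_re, Complex.zero_re] at h1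
  linarith

theorem one_sub_normSq_cayley {w : ℂ} (hw : w ∈ rightHalfPlane) :
    1 - ‖(w - 1) / (w + 1)‖ ^ 2 = 4 * w.re / ‖w + 1‖ ^ 2 := by
  have h1 : ‖w + 1‖ ≠ 0 := norm_ne_zero_iff.2 (cayley_add_one_ne_zero hw)
  have h2 := normSq_add_conj_sub w 1
  simp only [map_one, Complex.one_re, mul_one] at h2
  rw [norm_div, div_pow, ← h2]
  field_simp

theorem cayley_mem_unitDisk {w : ℂ} (hw : w ∈ rightHalfPlane) :
    (w - 1) / (w + 1) ∈ unitDisk := by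
  have h1 : 0 < ‖w + 1‖ := norm_pos_iff.2 (cayley_add_one_ne_zero hw)
  have h2 : 0 < 4 * w.re / ‖w + 1‖ ^ 2 := by
    have : 0 < w.re := hw
    positivity
  rw [← one_sub_normSq_cayley hw] at h2
  rw [mem_unitDisk]
  nlinarith [norm_nonneg ((w - 1) / (w + 1))]

theorem hasDerivAt_cayley {w : ℂ} (hw : w ∈ rightHalfPlane) :
    HasDerivAt (fun w : ℂ => (w - 1) / (w + 1)) (2 / (w + 1) ^ 2) w := by
  have h := ((hasDerivAt_id w).sub_const 1).div ((hasDerivAt_id w).add_const 1)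
    (cayley_add_one_ne_zero hw)
  refine h.congr_deriv ?_
  simp only [id]
  ring

theorem inv_cayley_mem_rightHalfPlane {z : ℂ} (hz : z ∈ unitDisk) :
    (1 + z) / (1 - z) ∈ rightHalfPlane := by
  change 0 < ((1 + z) / (1 - z)).re
  rw [re_herglotz_kernel norm_one]
  exact div_pos (one_sub_normSq_pos hz)
      (pow_pos (norm_pos_iff.2 (sub_ne_zero_of_mem_unitDisk norm_one hz)) 2)

theorem cayley_inv_cayley {z : ℂ} (hz : z ∈ unitDisk) :
    ((1 + z) / (1 - z) - 1) / ((1 + z) / (1 - z) + 1) = z := by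
  have h1 := sub_ne_zero_of_mem_unitDisk norm_one hz
  field_simp
  ring_nf

/-- If the real part vanishes somewhere, Harnack makes `q` an imaginary constant, and a rotation by
`c` restores the strict positivity required for Noshiro–Warschawski. -/
theorem exists_re_mul_pos {q : ℂ → ℂ} (hq : DifferentiableOn ℂ q unitDisk)
    (hre : ∀ z ∈ unitDisk, 0 ≤ (q z).re) (hq0 : ∀ z ∈ unitDisk, q z ≠ 0) :
    ∃ c : ℂ, ∀ z ∈ unitDisk, 0 < (c * q z).re := by
  by_cases h : ∀ z ∈ unitDisk, 0 < (q z).re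
  · exact ⟨1, by simpa using h⟩
  push Not at h
  obtain ⟨a, ha, hle⟩ := h
  have ha0 : (q a).re = 0 := le_antisymm hle (hre a ha)
  have hconst : ∀ z ∈ unitDisk, q z = (q a).im * Complex.I := fun z hz => by
    have := harnack_re_nonneg hq hre ha hz
    rw [ha0] at this
    simp only [mul_zero, zero_mul, zero_div] at this
    exact sub_eq_zero.1 (norm_le_zero_iff.1 this)
  have him : (q a).im ≠ 0 := fun h => hq0 a ha (Complex.ext ha0 h)
  refine ⟨-(q a).im * Complex.I, fun z hz => ?_⟩
  rw [hconst z hz]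
  have : (-(q a).im * Complex.I * ((q a).im * Complex.I) : ℂ) = (((q a).im ^ 2 : ℝ) : ℂ) := by
    push_cast
    linear_combination -((q a).im : ℂ) ^ 2 * Complex.I_sq
  rw [this, Complex.ofReal_re]
  positivity

/-- The sufficiency part of the Berkson-Porta formula for the Denjoy-Wolff point `1`. -/
theorem isSemigroupGenerator_of_re_nonneg {q : ℂ → ℂ} (hq : DifferentiableOn ℂ q unitDisk)
    (hre : ∀ z ∈ unitDisk, 0 ≤ (q z).re) (hq0 : ∀ z ∈ unitDisk, q z ≠ 0) :
    IsSemigroupGenerator (fun z => -(1 - z) ^ 2 / q z) := by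
  have h1z : ∀ z ∈ unitDisk, 1 - z ≠ 0 := fun z hz => sub_ne_zero_of_mem_unitDisk norm_one hz
  have hσd : DifferentiableOn ℂ (fun z => q z / (1 - z) ^ 2) unitDisk :=
    hq.div (by fun_prop) fun z hz => pow_ne_zero 2 (h1z z hz)
  -- An Abel function: the semigroup is to satisfy `σ (F t z) = σ z + t`.
  obtain ⟨σ, hσ⟩ := DifferentiableOn.isExactOn_ball hσd
  change ∀ z ∈ unitDisk, _ at hσ
  let k : ℂ → ℂ := fun w => (w - 1) / (w + 1)
  have hkH : ∀ w ∈ rightHalfPlane, k w ∈ unitDisk := fun w hw => cayley_mem_unitDisk hw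
  let S : ℂ → ℂ := fun w => σ (k w)
  -- The velocity field of the flow in the half-plane coordinate.
  let P : ℂ → ℂ := fun w => 2 * (q (k w))⁻¹
  let p : ℂ → ℂ := fun z => (q z)⁻¹
  have hp : DifferentiableOn ℂ p unitDisk := hq.inv hq0
  have hpre : ∀ z ∈ unitDisk, 0 ≤ (p z).re := fun z hz => by
    simp only [p, Complex.inv_re]
    exact div_nonneg (hre z hz) (Complex.normSq_nonneg _)
  have hP0 : ∀ w ∈ rightHalfPlane, P w ≠ 0 := fun w hw =>
    mul_ne_zero two_ne_zero (inv_ne_zero (hq0 _ (hkH w hw)))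
  have hS : ∀ w ∈ rightHalfPlane, HasDerivAt S (P w)⁻¹ w := by
    intro w hw
    have h := (hσ _ (hkH w hw)).comp w (hasDerivAt_cayley hw)
    refine h.congr_deriv ?_
    have h1 := cayley_add_one_ne_zero hw
    have h2 : 1 - k w = 2 / (w + 1) := by
      simp only [k]; field_simp; ring
    have h3 := hq0 _ (hkH w hw)
    simp only [P, h2]
    field_simp
  obtain ⟨c, hc⟩ := exists_re_mul_pos hq hre hq0
  have hinj : Set.InjOn S rightHalfPlane := by
    refine injOn_of_re_mul_deriv_pos (c := 2 * c) hS fun w hw => ?_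
    have h := hc _ (hkH w hw)
    have : 2 * c * (P w)⁻¹ = c * q (k w) := by
      simp only [P, mul_inv_rev, inv_inv]
      ring
    rwa [this]
  have hPd : ∀ w ∈ rightHalfPlane, HasDerivAt P (2 * (deriv p (k w) * (2 / (w + 1) ^ 2))) w := by
    intro w hw
    have h1 : HasDerivAt p (deriv p (k w)) (k w) :=
      (hp.differentiableAt (isOpen_unitDisk.mem_nhds (hkH w hw))).hasDerivAt
    exact (h1.comp w (hasDerivAt_cayley hw)).const_mul 2
  have hPb : ∀ w ∈ rightHalfPlane,
      ‖2 * (deriv p (k w) * (2 / (w + 1) ^ 2))‖ * w.re ≤ (P w).re := by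
    intro w hw
    have h1 := norm_deriv_le_of_re_nonneg hp hpre (hkH w hw)
    have h2 : 1 - ‖k w‖ ^ 2 = 4 * w.re / ‖w + 1‖ ^ 2 := one_sub_normSq_cayley hw
    rw [h2] at h1
    have h3 : (P w).re = 2 * (p (k w)).re := by
      simp [P, p]
    rw [h3]
    refine le_trans (le_of_eq ?_) h1
    simp only [norm_mul, norm_div, norm_pow, Complex.norm_ofNat]
    ring
  set ψ := Function.invFunOn S rightHalfPlane with hψ
  have hSinv : ∀ z ∈ unitDisk, S ((1 + z) / (1 - z)) = σ z := fun z hz => by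
    simp only [S, k]
    rw [cayley_inv_cayley hz]
  have himg : ∀ z ∈ unitDisk, ∀ t : ℝ, 0 ≤ t → σ z + t ∈ S '' rightHalfPlane := by
    intro z hz t ht
    rw [← hSinv z hz]
    exact add_ofReal_mem_image hS hP0 hinj hPd hPb (inv_cayley_mem_rightHalfPlane hz) ht
  have hψmem : ∀ z ∈ unitDisk, ∀ t : ℝ, 0 ≤ t → ψ (σ z + t) ∈ rightHalfPlane :=
    fun z hz t ht => Function.invFunOn_mem (himg z hz t ht)
  have hψeq : ∀ z ∈ unitDisk, ∀ t : ℝ, 0 ≤ t → σ (k (ψ (σ z + t))) = σ z + t :=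
    fun z hz t ht => Function.invFunOn_eq (himg z hz t ht)
  have hψ0 : ∀ z ∈ unitDisk, ψ (σ z) = (1 + z) / (1 - z) := fun z hz => by
    rw [← hSinv z hz]
    exact hinj.leftInvOn_invFunOn (inv_cayley_mem_rightHalfPlane hz)
  have hflow : ∀ z ∈ unitDisk, ∀ t : ℝ, 0 ≤ t →
      HasDerivAt (fun y => k (ψ y))
        (2 / (ψ (σ z + t) + 1) ^ 2 * P (ψ (σ z + t))) (σ z + t) := by
    intro z hz t ht
    have h1 := hasDerivAt_invFunOn hS hP0 hinj (hψmem z hz t ht)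
    have h2 : S (ψ (σ z + t)) = σ z + t := hψeq z hz t ht
    rw [h2] at h1
    exact (hasDerivAt_cayley (hψmem z hz t ht)).comp _ h1
  refine ⟨fun t z => k (ψ (σ z + t)), ⟨?_, ?_, ?_, ?_⟩, ?_, ?_⟩
  · intro t ht z hz
    exact ((hflow z hz t ht).comp z
      ((hσ z hz).add_const _)).differentiableAt.differentiableWithinAt
  · intro t ht z hz
    exact hkH _ (hψmem z hz t ht)
  · intro s t hs ht z hz
    rw [hψeq z hz t ht]
    congr 2
    push_cast
    ring
  · intro z hz
    simp only [Complex.ofReal_zero, add_zero]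
    rw [hψ0 z hz]
    exact cayley_inv_cayley hz
  · exact DifferentiableOn.div (by fun_prop) hq hq0
  · intro z hz
    have h1 := hflow z hz 0 le_rfl
    have h2 : HasDerivAt (fun s : ℝ => σ z + (s : ℂ)) 1 0 :=
      (Complex.ofRealCLM.hasDerivAt (x := (0 : ℝ))).const_add (σ z)
    have h3 := (h1.comp (0 : ℝ) h2).tendsto_slope_zero_right
    have hk0 : k (ψ (σ z)) = z := by
      rw [hψ0 z hz]
      exact cayley_inv_cayley hz
    simp only [Function.comp_apply, zero_add, Complex.ofReal_zero, add_zero, hk0, mul_one] at h3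
    have h4 := h3.neg
    have hval : -(2 / (ψ (σ z) + 1) ^ 2 * P (ψ (σ z))) = -(1 - z) ^ 2 / q z := by
      simp only [P]
      rw [hk0, hψ0 z hz]
      have e1 := h1z z hz
      have e2 := hq0 z hz
      have e3 : (1 + z) / (1 - z) + 1 = 2 / (1 - z) := by field_simp; ring
      rw [e3]
      field_simp
    rw [hval] at h4
    refine h4.congr fun t => ?_
    rw [Complex.real_smul, Complex.ofReal_inv]
    ring

/-! ### Angular limits and removal of point masses. -/

/-- The radius ending at `ζ` lies in the region of aperture `2`; this makes angular limits unique.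
-/
theorem stolzRegion_neBot {ζ : ℂ} (hζ : ‖ζ‖ = 1) : (𝓝[stolzRegion ζ 2] ζ).NeBot := by
  have h : Tendsto (fun r : ℝ => (r : ℂ) * ζ) (𝓝[<] 1) (𝓝[stolzRegion ζ 2] ζ) := by
    refine tendsto_nhdsWithin_iff.2 ⟨?_, ?_⟩
    · have hc : Continuous fun r : ℝ => (r : ℂ) * ζ := by fun_prop
      exact (hc.tendsto' 1 ζ (by simp)).mono_left nhdsWithin_le_nhds
    · filter_upwards [Ioo_mem_nhdsLT (zero_lt_one' ℝ)] with r hr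
      have hn : ‖(r : ℂ) * ζ‖ = r := by
        rw [norm_mul, hζ, mul_one, Complex.norm_real, Real.norm_of_nonneg hr.1.le]
      refine ⟨mem_unitDisk.2 (by rw [hn]; exact hr.2), ?_⟩
      have hs : ‖(r : ℂ) * ζ - ζ‖ = 1 - r := by
        rw [show (r : ℂ) * ζ - ζ = ((r - 1 : ℝ) : ℂ) * ζ by push_cast; ring, norm_mul, hζ, mul_one,
          Complex.norm_real, Real.norm_of_nonpos (by linarith [hr.2])]
        ring
      rw [hs, hn]
      linarith [hr.2]
  exact h.neBot

theorem AngularTendsto.unique {φ : ℂ → ℂ} {ζ a b : ℂ} (hζ : ‖ζ‖ = 1)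
    (ha : AngularTendsto φ ζ (𝓝 a)) (hb : AngularTendsto φ ζ (𝓝 b)) : a = b := by
  have := stolzRegion_neBot hζ
  exact tendsto_nhds_unique (ha 2) (hb 2)

theorem AngularTendsto.congr {φ χ : ℂ → ℂ} {ζ : ℂ} {l : Filter ℂ} (h : AngularTendsto φ ζ l)
    (heq : ∀ z ∈ unitDisk, φ z = χ z) : AngularTendsto χ ζ l := fun M =>
  (h M).congr' (eventually_nhdsWithin_of_forall fun z hz => heq z hz.1)

theorem AngularTendsto.mul {φ χ : ℂ → ℂ} {ζ a b : ℂ} (hφ : AngularTendsto φ ζ (𝓝 a))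
    (hχ : AngularTendsto χ ζ (𝓝 b)) : AngularTendsto (fun z => φ z * χ z) ζ (𝓝 (a * b)) :=
  fun M => (hφ M).mul (hχ M)

theorem AngularTendsto.add {φ χ : ℂ → ℂ} {ζ a b : ℂ} (hφ : AngularTendsto φ ζ (𝓝 a))
    (hχ : AngularTendsto χ ζ (𝓝 b)) : AngularTendsto (fun z => φ z + χ z) ζ (𝓝 (a + b)) :=
  fun M => (hφ M).add (hχ M)

theorem AngularTendsto.sub {φ χ : ℂ → ℂ} {ζ a b : ℂ} (hφ : AngularTendsto φ ζ (𝓝 a))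
    (hχ : AngularTendsto χ ζ (𝓝 b)) : AngularTendsto (fun z => φ z - χ z) ζ (𝓝 (a - b)) :=
  fun M => (hφ M).sub (hχ M)

theorem ContinuousAt.angularTendsto {φ : ℂ → ℂ} {ζ : ℂ} (h : ContinuousAt φ ζ) :
    AngularTendsto φ ζ (𝓝 (φ ζ)) := fun _ => h.tendsto.mono_left nhdsWithin_le_nhds

theorem hasAngularDeriv_of_quotient {f : ℂ → ℂ} {ζ d : ℂ} (hζ : ‖ζ‖ = 1)
    (h : AngularTendsto (fun z => f z / (z - ζ)) ζ (𝓝 d)) : HasAngularDeriv f ζ 0 d := by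
  refine ⟨?_, by simpa using h⟩
  have h1 := h.mul (ContinuousAt.angularTendsto (φ := fun z => z - ζ) (ζ := ζ) (by fun_prop))
  simp only [sub_self, mul_zero] at h1
  refine h1.congr fun z hz => div_mul_cancel₀ _ ?_
  rw [← neg_sub]
  exact neg_ne_zero.2 (sub_ne_zero_of_mem_unitDisk hζ hz)

theorem angularTendsto_mul_kernel_self {ζ : ℂ} (hζ : ‖ζ‖ = 1) (c : ℂ) :
    AngularTendsto (fun z => (ζ - z) * (c * ((ζ + z) / (ζ - z)))) ζ (𝓝 (2 * c * ζ)) := by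
  have h := ContinuousAt.angularTendsto (φ := fun z => c * (ζ + z)) (ζ := ζ) (by fun_prop)
  rw [show c * (ζ + ζ) = 2 * c * ζ by ring] at h
  refine h.congr fun z hz => ?_
  have := sub_ne_zero_of_mem_unitDisk hζ hz
  field_simp

theorem angularTendsto_mul_kernel_ne {ζ η : ℂ} (hne : η ≠ ζ) (c : ℂ) :
    AngularTendsto (fun z => (ζ - z) * (c * ((η + z) / (η - z)))) ζ (𝓝 0) := by
  have hc : ContinuousAt (fun z => (ζ - z) * (c * ((η + z) / (η - z)))) ζ := by
    have : η - ζ ≠ 0 := sub_ne_zero.2 hne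
    fun_prop (disch := assumption)
  simpa using hc.angularTendsto

theorem angularTendsto_mul_sum_kernel {ι : Type*} [DecidableEq ι] {ζ : ι → ℂ}
    (hinj : Function.Injective ζ) (hζ : ∀ n, ‖ζ n‖ = 1) (c : ι → ℝ) (s : Finset ι) (m : ι) :
    AngularTendsto (fun z => (ζ m - z) * ∑ n ∈ s, (c n : ℂ) * ((ζ n + z) / (ζ n - z))) (ζ m)
      (𝓝 (if m ∈ s then 2 * c m * ζ m else 0)) := by
  have h : AngularTendsto
      (fun z => ∑ n ∈ s, (ζ m - z) * ((c n : ℂ) * ((ζ n + z) / (ζ n - z)))) (ζ m)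
      (𝓝 (∑ n ∈ s, if m = n then (2 * c m * ζ m : ℂ) else 0)) := by
    intro M
    refine tendsto_finsetSum _ fun n _ => ?_
    split_ifs with hmn
    · subst hmn
      exact angularTendsto_mul_kernel_self (hζ m) (c m) M
    · exact angularTendsto_mul_kernel_ne (fun h => hmn (hinj h).symm) (c n) M
  rw [Finset.sum_ite_eq] at h
  exact h.congr fun z _ => (Finset.mul_sum _ _ _).symm

/-- Removing finitely many point masses of the Herglotz measure keeps the real part nonnegative. -/
theorem re_sub_sum_kernel_nonneg {ι : Type*} [DecidableEq ι] {ζ : ι → ℂ}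
    (hinj : Function.Injective ζ) (hζ : ∀ n, ‖ζ n‖ = 1) {c : ι → ℝ} {q : ℂ → ℂ}
    (hq : DifferentiableOn ℂ q unitDisk) (hre : ∀ z ∈ unitDisk, 0 ≤ (q z).re)
    (hmass : ∀ n, AngularTendsto (fun z => (ζ n - z) * q z) (ζ n) (𝓝 (2 * c n * ζ n)))
    (s : Finset ι) :
    ∀ z ∈ unitDisk, 0 ≤ (q z - ∑ n ∈ s, (c n : ℂ) * ((ζ n + z) / (ζ n - z))).re := by
  induction s using Finset.induction_on with
  | empty => simpa using hre
  | insert m s hm ih =>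
    have hd : DifferentiableOn ℂ
        (fun z => q z - ∑ n ∈ s, (c n : ℂ) * ((ζ n + z) / (ζ n - z))) unitDisk :=
      hq.sub (DifferentiableOn.fun_sum fun n _ =>
        (differentiableOn_herglotz_kernel (hζ n)).const_mul _)
    -- Kernels at the other points do not affect the limit at `ζ m`, so the mass `c'` of the
    -- remainder must be `c m`.
    obtain ⟨c', -, hc', hlim⟩ := exists_point_mass hd ih (hζ m)
    have hlim' := (hmass m).sub (angularTendsto_mul_sum_kernel hinj hζ c s m)
    rw [if_neg hm, sub_zero] at hlim'
    have heq := (hlim.congr fun z _ => mul_sub _ _ _).unique (hζ m) hlim'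
    have hζ0 : ζ m ≠ 0 := norm_ne_zero_iff.1 (by rw [hζ m]; exact one_ne_zero)
    have hcc : c' = c m := by
      have h1 := mul_right_cancel₀ hζ0 heq
      have h2 := mul_left_cancel₀ two_ne_zero h1
      exact_mod_cast h2
    intro z hz
    rw [Finset.sum_insert hm]
    have := hc' z hz
    rw [hcc] at this
    convert this using 2
    ring

/-- A consequence of `conj ζ = 1/ζ`. It is the reason why the angular derivatives at the null points
are real. -/
theorem ofReal_normSq_one_sub {ζ : ℂ} (hζ : ‖ζ‖ = 1) :
    ((‖1 - ζ‖ ^ 2 : ℝ) : ℂ) * ζ = -(1 - ζ) ^ 2 := by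
  have h1 : ζ * (starRingEnd ℂ) ζ = 1 := by
    rw [Complex.mul_conj, Complex.normSq_eq_norm_sq, hζ]; simp
  rw [← Complex.normSq_eq_norm_sq, ← Complex.mul_conj, map_sub, map_one]
  linear_combination -(1 - ζ) * h1

theorem kernel_at_one_eq {ζ z : ℂ} (hζ : ‖ζ‖ = 1) (hz : z ∈ unitDisk) :
    (1 - z) * (1 - ζ) / (z - ζ) =
      ((‖1 - ζ‖ ^ 2 / 2 : ℝ) : ℂ) * ((ζ + z) / (ζ - z)) + ζ.im * Complex.I := by
  have hζ0 : ζ ≠ 0 := norm_ne_zero_iff.1 (by rw [hζ]; exact one_ne_zero)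
  have h1 : ζ * (starRingEnd ℂ) ζ = 1 := by
    rw [Complex.mul_conj, Complex.normSq_eq_norm_sq, hζ]; simp
  have h2 := ofReal_normSq_one_sub hζ
  have h3 := sub_ne_zero_of_mem_unitDisk hζ hz
  have h4 : z - ζ ≠ 0 := by rw [← neg_sub]; exact neg_ne_zero.2 h3
  have h5 : ζ - (starRingEnd ℂ) ζ = 2 * (ζ.im * Complex.I) := by
    rw [Complex.sub_conj]; push_cast; ring
  have h6 : ((‖1 - ζ‖ ^ 2 / 2 : ℝ) : ℂ) = ((‖1 - ζ‖ ^ 2 : ℝ) : ℂ) / 2 := by push_cast; ring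
  rw [h6, show z - ζ = -(ζ - z) by ring]
  generalize ((‖1 - ζ‖ ^ 2 : ℝ) : ℂ) = n at *
  generalize (ζ.im * Complex.I : ℂ) = b at *
  have h7 : ζ ^ 2 - 1 = 2 * b * ζ := by linear_combination ζ * h5 + h1
  rw [← sub_eq_zero]
  have : 2 * ζ * (ζ - z) * ((1 - z) * (1 - ζ) / -(ζ - z) - (n / 2 * ((ζ + z) / (ζ - z)) + b)) = 0 := by
    field_simp
    linear_combination -(ζ + z) * h2 + (ζ - z) * h7
  simpa [hζ0, h3] using this

/-- The quotient is the reciprocal of a nonvanishing multiple of `(ζ - z) q z`, with a factor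
continuous at `ζ` since `ζ ≠ 1`. -/
theorem angularTendsto_cobounded {q : ℂ → ℂ} {ζ : ℂ} (hζ : ‖ζ‖ = 1) (hζ1 : ζ ≠ 1)
    (hq0 : ∀ z ∈ unitDisk, q z ≠ 0) (hlim : AngularTendsto (fun z => (ζ - z) * q z) ζ (𝓝 0)) :
    AngularTendsto (fun z => -(1 - z) ^ 2 / q z / (z - ζ)) ζ (Bornology.cobounded ℂ) := by
  have h1 : 1 - ζ ≠ 0 := sub_ne_zero.2 hζ1.symm
  have hc : ContinuousAt (fun z : ℂ => ((1 - z) ^ 2)⁻¹) ζ := by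
    have := pow_ne_zero 2 h1
    fun_prop (disch := assumption)
  intro M
  have h2 := (hlim M).mul (hc.angularTendsto M)
  rw [zero_mul] at h2
  have h3 : Tendsto (fun z => (ζ - z) * q z * ((1 - z) ^ 2)⁻¹) (𝓝[stolzRegion ζ M] ζ)
      (𝓝[≠] 0) := by
    refine tendsto_nhdsWithin_iff.2 ⟨h2, eventually_nhdsWithin_of_forall fun z hz => ?_⟩
    exact mul_ne_zero (mul_ne_zero (sub_ne_zero_of_mem_unitDisk hζ hz.1) (hq0 z hz.1))
      (inv_ne_zero (pow_ne_zero 2 (sub_ne_zero_of_mem_unitDisk norm_one hz.1)))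
  refine (tendsto_inv₀_nhdsNE_zero.comp h3).congr' (eventually_nhdsWithin_of_forall fun z hz => ?_)
  have e1 := sub_ne_zero_of_mem_unitDisk hζ hz.1
  have e2 := sub_ne_zero_of_mem_unitDisk norm_one hz.1
  have e3 := hq0 z hz.1
  simp only [Function.comp_apply]
  rw [show z - ζ = -(ζ - z) by ring]
  field_simp

/-! ### The decomposition of `1/f`. -/

theorem theorem4p1 (f : ℂ → ℂ) (F : ℝ → ℂ → ℂ)
    (hF : IsHolomorphicSemigroup F) (hf : IsGeneratorOf f F) (hDW : IsDenjoyWolffPoint F 1)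
    (N : ℕ) (ζ : Fin N → ℂ) (hζ_inj : Function.Injective ζ)
    (hζ_norm : ∀ n, ‖ζ n‖ = 1) (hζ_ne : ∀ n, ζ n ≠ 1)
    (d : Fin N → ℂ) (hd : ∀ n, HasAngularDeriv f (ζ n) 0 (d n)) :
    (∀ n, (d n).im = 0 ∧ (d n).re < 0) ∧
    (∀ z ∈ unitDisk, f z ≠ 0) ∧
    ∃ α : ℝ, 0 ≤ α ∧ HasAngularDeriv f 1 0 (α : ℂ) ∧
      ∃ (r : ℝ) (h : ℂ → ℂ), 0 ≤ r ∧ IsSemigroupGenerator h ∧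
        (∀ z ∈ unitDisk, h z ≠ 0) ∧
        HasAngularDeriv h 1 0 (α : ℂ) ∧
        (∀ n, AngularTendsto (fun z => h z / (z - ζ n)) (ζ n) (Bornology.cobounded ℂ)) ∧
        ∀ z ∈ unitDisk,
          1 / f z = ∑ n, (1 / (‖d n‖ : ℂ)) * (1 / (z - 1) - 1 / (z - ζ n)) + (r : ℂ) / h z := by
  have hf0 : ∀ z ∈ unitDisk, f z ≠ 0 := fun z hz => generator_ne_zero hF hf hDW hz
  have h1z : ∀ z ∈ unitDisk, 1 - z ≠ 0 := fun z hz => sub_ne_zero_of_mem_unitDisk norm_one hz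
  have hζz : ∀ n, ∀ z ∈ unitDisk, ζ n - z ≠ 0 := fun n z hz =>
    sub_ne_zero_of_mem_unitDisk (hζ_norm n) hz
  have hzζ : ∀ n, ∀ z ∈ unitDisk, z - ζ n ≠ 0 := fun n z hz => by
    rw [← neg_sub]; exact neg_ne_zero.2 (hζz n z hz)
  have h1ζ : ∀ n, 1 - ζ n ≠ 0 := fun n => sub_ne_zero.2 (hζ_ne n).symm
  have hζ0 : ∀ n, ζ n ≠ 0 := fun n => norm_ne_zero_iff.1 (by rw [hζ_norm n]; exact one_ne_zero)
  let p : ℂ → ℂ := fun z => -f z / (1 - z) ^ 2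
  let q : ℂ → ℂ := fun z => (p z)⁻¹
  have hpd : DifferentiableOn ℂ p unitDisk :=
    hf.1.neg.div (by fun_prop) fun z hz => pow_ne_zero 2 (h1z z hz)
  have hpre : ∀ z ∈ unitDisk, 0 ≤ (p z).re := fun z hz => re_berkson_porta_nonneg hF hf hDW hz
  have hp0 : ∀ z ∈ unitDisk, p z ≠ 0 := fun z hz =>
    div_ne_zero (neg_ne_zero.2 (hf0 z hz)) (pow_ne_zero 2 (h1z z hz))
  have hqd : DifferentiableOn ℂ q unitDisk := hpd.inv hp0
  have hqre : ∀ z ∈ unitDisk, 0 ≤ (q z).re := fun z hz => by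
    simp only [q, Complex.inv_re]
    exact div_nonneg (hpre z hz) (Complex.normSq_nonneg _)
  choose c hc0 _ hcm using fun n => exists_point_mass hqd hqre (hζ_norm n)
  -- The product of `f z / (z - ζ n)` and `(ζ n - z) * q z` is exactly `(1 - z) ^ 2`. Its nonzero
  -- limit also forces `c n > 0`.
  have hdc : ∀ n, d n * (2 * c n) = -((‖1 - ζ n‖ ^ 2 : ℝ) : ℂ) := by
    intro n
    have h1 := ((hd n).2).mul (hcm n)
    have h2 := ContinuousAt.angularTendsto (φ := fun z => (1 - z) ^ 2) (ζ := ζ n) (by fun_prop)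
    have h3 := h2.unique (hζ_norm n) (h1.congr fun z hz => by
      have e1 := hf0 z hz
      have e2 := h1z z hz
      have e3 := hzζ n z hz
      simp only [q, p, sub_zero]
      rw [show ζ n - z = -(z - ζ n) by ring]
      field_simp)
    refine mul_right_cancel₀ (hζ0 n) ?_
    rw [neg_mul, ofReal_normSq_one_sub (hζ_norm n), neg_neg, h3]
    ring
  have hcpos : ∀ n, 0 < c n := by
    intro n
    refine lt_of_le_of_ne (hc0 n) fun h => ?_
    have h1 := hdc n
    rw [← h, Complex.ofReal_zero, mul_zero, mul_zero, eq_comm, neg_eq_zero,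
      Complex.ofReal_eq_zero] at h1
    exact h1ζ n (norm_eq_zero.1 (pow_eq_zero_iff two_ne_zero |>.1 h1))
  have hdeq : ∀ n, d n = ((-(‖1 - ζ n‖ ^ 2 / (2 * c n)) : ℝ) : ℂ) := by
    intro n
    have h1 : (c n : ℂ) ≠ 0 := by exact_mod_cast (hcpos n).ne'
    have h2 := hdc n
    push_cast at h2 ⊢
    field_simp
    linear_combination h2
  have hquot : ∀ n, 0 < ‖1 - ζ n‖ ^ 2 / (2 * c n) := fun n =>
    div_pos (pow_pos (norm_pos_iff.2 (h1ζ n)) 2) (mul_pos two_pos (hcpos n))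
  have hdn : ∀ n, ‖d n‖ = ‖1 - ζ n‖ ^ 2 / (2 * c n) := fun n => by
    rw [hdeq n, Complex.norm_real, norm_neg, Real.norm_of_nonneg (hquot n).le]
  refine ⟨fun n => ?_, hf0, ?_⟩
  · rw [hdeq n, Complex.ofReal_im, Complex.ofReal_re]
    exact ⟨rfl, neg_neg_of_pos (hquot n)⟩
  obtain ⟨a, ha0, -, hplim⟩ := exists_point_mass hpd hpre norm_one
  obtain ⟨α, hα0, hplim⟩ : ∃ α : ℝ, 0 ≤ α ∧ AngularTendsto (fun z => (1 - z) * p z) 1 (𝓝 α) :=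
    ⟨2 * a, by positivity, by simpa using hplim⟩
  refine ⟨α, hα0, hasAngularDeriv_of_quotient norm_one (hplim.congr fun z hz => ?_), ?_⟩
  · have e1 := h1z z hz
    simp only [p]
    rw [show z - 1 = -(1 - z) by ring]
    field_simp
  -- Chosen so that the sum in the theorem equals `-T z / (1 - z)`.
  let T : ℂ → ℂ := fun z => ∑ n, (1 / (‖d n‖ : ℂ)) * ((1 - ζ n) / (z - ζ n))
  let q₂ : ℂ → ℂ := fun z => q z - (1 - z) * T z
  have hT : AngularTendsto T 1 (𝓝 ((∑ n, 1 / ‖d n‖ : ℝ) : ℂ)) := by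
    have hcont : ContinuousAt T 1 := by
      refine tendsto_finsetSum _ fun n _ => ?_
      refine ContinuousAt.tendsto (f := fun z => (1 / (‖d n‖ : ℂ)) * ((1 - ζ n) / (z - ζ n))) ?_
      have := h1ζ n
      fun_prop (disch := assumption)
    have hval : T 1 = ((∑ n, 1 / ‖d n‖ : ℝ) : ℂ) := by
      simp only [T]
      push_cast
      exact Finset.sum_congr rfl fun n _ => by rw [div_self (h1ζ n), mul_one]
    rw [← hval]
    exact hcont.angularTendsto
  have hs0 : 0 ≤ ∑ n, 1 / ‖d n‖ := Finset.sum_nonneg fun n _ => by positivity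
  set σ := ∑ n, 1 / ‖d n‖ with hσ
  have hTd : DifferentiableOn ℂ T unitDisk := DifferentiableOn.fun_sum fun n _ =>
    DifferentiableOn.const_mul (DifferentiableOn.div (by fun_prop) (by fun_prop) (hzζ n)) _
  have hq₂d : DifferentiableOn ℂ q₂ unitDisk := hqd.sub (DifferentiableOn.mul (by fun_prop) hTd)
  have hq₂eq : ∀ z ∈ unitDisk, q₂ z = q z - ∑ n, (c n : ℂ) * ((ζ n + z) / (ζ n - z)) -
      ((∑ n, (ζ n).im / ‖d n‖ : ℝ) : ℂ) * Complex.I := by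
    intro z hz
    simp only [q₂, T]
    rw [sub_sub, sub_right_inj, Finset.mul_sum, Complex.ofReal_sum, Finset.sum_mul,
      ← Finset.sum_add_distrib]
    refine Finset.sum_congr rfl fun n _ => ?_
    have hcn : 1 / ‖d n‖ * (‖1 - ζ n‖ ^ 2 / 2) = c n := by
      have e1 := norm_ne_zero_iff.2 (h1ζ n)
      have e2 := (hcpos n).ne'
      rw [hdn n]
      field_simp
    have h1 := kernel_at_one_eq (hζ_norm n) hz
    rw [← hcn]
    calc _ = 1 / (‖d n‖ : ℂ) * ((1 - z) * (1 - ζ n) / (z - ζ n)) := by ring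
      _ = _ := by
        rw [h1]
        push_cast
        ring
  have hq₂re : ∀ z ∈ unitDisk, 0 ≤ (q₂ z).re := by
    intro z hz
    have := re_sub_sum_kernel_nonneg hζ_inj hζ_norm hqd hqre hcm Finset.univ z hz
    rw [hq₂eq z hz, Complex.sub_re]
    simpa using this
  have hq₂lim : ∀ n, AngularTendsto (fun z => (ζ n - z) * q₂ z) (ζ n) (𝓝 0) := by
    intro n
    have h1 := (hcm n).sub (angularTendsto_mul_sum_kernel hζ_inj hζ_norm c Finset.univ n)
    rw [if_pos (Finset.mem_univ n), sub_self] at h1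
    have h2 := h1.sub (ContinuousAt.angularTendsto
      (φ := fun z => (ζ n - z) * (((∑ n, (ζ n).im / ‖d n‖ : ℝ) : ℂ) * Complex.I)) (ζ := ζ n)
      (by fun_prop))
    rw [sub_self, zero_mul, sub_zero] at h2
    refine h2.congr fun z hz => ?_
    rw [hq₂eq z hz]
    ring
  obtain ⟨r, g, hr, hgd, hgre, hg0, hglim, hg1, hrg⟩ : ∃ (r : ℝ) (g : ℂ → ℂ), 0 ≤ r ∧
      DifferentiableOn ℂ g unitDisk ∧ (∀ z ∈ unitDisk, 0 ≤ (g z).re) ∧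
      (∀ z ∈ unitDisk, g z ≠ 0) ∧
      (∀ n, AngularTendsto (fun z => (ζ n - z) * g z) (ζ n) (𝓝 0)) ∧
      AngularTendsto (fun z => (1 - z) / g z) 1 (𝓝 α) ∧ ∀ z ∈ unitDisk, q₂ z = r * g z := by
    by_cases hzero : ∃ b ∈ unitDisk, q₂ b = 0
    · obtain ⟨b, hb, hb0⟩ := hzero
      have hz0 := eq_zero_of_re_nonneg hq₂d hq₂re hb hb0
      have hασ : (α : ℂ) * (σ : ℂ) = 1 := by
        refine (hplim.mul hT).unique norm_one ?_
        refine (ContinuousAt.angularTendsto (φ := fun _ => (1 : ℂ)) (ζ := 1)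
          continuousAt_const).congr fun z hz => ?_
        have h1 : q z = (1 - z) * T z := sub_eq_zero.1 (hz0 z hz)
        rw [mul_right_comm, ← h1]
        exact (inv_mul_cancel₀ (hp0 z hz)).symm
      have hα : α ≠ 0 := by
        rintro rfl
        simp at hασ
      have hαpos : 0 < α := lt_of_le_of_ne hα0 hα.symm
      have hαc : (α : ℂ) ≠ 0 := by exact_mod_cast hα
      -- With `r = 0` any admissible `g` will do; this one gives `h z = α (z - 1)`.
      refine ⟨0, fun z => (1 - z) / α, le_rfl, by fun_prop, fun z hz => ?_,
        fun z hz => div_ne_zero (h1z z hz) hαc, fun n => ?_, ?_, fun z hz => ?_⟩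
      · rw [Complex.div_ofReal_re, Complex.sub_re, Complex.one_re]
        have := (Complex.re_le_norm z).trans (mem_unitDisk.1 hz).le
        exact div_nonneg (sub_nonneg.2 this) hα0
      · simpa using ContinuousAt.angularTendsto
          (φ := fun z => (ζ n - z) * ((1 - z) / α)) (ζ := ζ n) (by fun_prop)
      · refine (ContinuousAt.angularTendsto (φ := fun _ => (α : ℂ)) (ζ := 1)
          continuousAt_const).congr fun z hz => ?_
        have := h1z z hz
        field_simp
      · rw [hz0 z hz, Complex.ofReal_zero, zero_mul]
    · push Not at hzero
      have hp₂re : ∀ z ∈ unitDisk, 0 ≤ ((q₂ z)⁻¹).re := fun z hz => by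
        rw [Complex.inv_re]
        exact div_nonneg (hq₂re z hz) (Complex.normSq_nonneg _)
      obtain ⟨b, hb0, -, hblim⟩ := exists_point_mass (hq₂d.inv hzero) hp₂re norm_one
      obtain ⟨β, hβ0, hβ⟩ : ∃ β : ℝ, 0 ≤ β ∧
          AngularTendsto (fun z => (1 - z) * (q₂ z)⁻¹) 1 (𝓝 β) :=
        ⟨2 * b, by positivity, by simpa using hblim⟩
      -- Angular limit at `1` of the identity `p q₂ + (1 - z) p T = 1` multiplied by `(1 - z)/q₂`.
      have hrel : β = α + α * β * σ := by
        have h1 := hβ.unique norm_one ((hplim.add ((hplim.mul hβ).mul hT)).congr fun z hz => by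
          have e1 := hzero z hz
          have e2 := hp0 z hz
          have e3 : q₂ z = (p z)⁻¹ - (1 - z) * T z := rfl
          have e4 : p z * q₂ z + p z * ((1 - z) * T z) = 1 := by
            rw [e3, mul_sub, mul_inv_cancel₀ e2]; ring
          rw [← sub_eq_zero]
          have : q₂ z * ((1 - z) * p z + (1 - z) * p z * ((1 - z) * (q₂ z)⁻¹) * T z -
              (1 - z) * (q₂ z)⁻¹) = 0 := by
            field_simp
            linear_combination (1 - z) * e4
          simpa [e1] using this)
        exact_mod_cast h1
      -- If `α > 0` and `α σ ≥ 1`, then `hrel` would give `β ≥ α + β`.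
      have hrpos : 0 < 1 - α * σ := by
        rcases hα0.eq_or_lt with h | h
        · rw [← h]; norm_num
        · by_contra hneg
          nlinarith [mul_nonneg hβ0 (sub_nonneg.2 (sub_nonpos.1 (not_lt.1 hneg)))]
      set r := 1 - α * σ with hrdef
      have hrc : (r : ℂ) ≠ 0 := by exact_mod_cast hrpos.ne'
      have hrβ : r * β = α := by rw [hrdef]; linarith
      refine ⟨r, fun z => q₂ z / r, hrpos.le, hq₂d.div_const _, fun z hz => ?_,
        fun z hz => div_ne_zero (hzero z hz) hrc, fun n => ?_, ?_, fun z hz => ?_⟩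
      · rw [Complex.div_ofReal_re]
        exact div_nonneg (hq₂re z hz) hrpos.le
      · intro M
        simpa [mul_div_assoc] using ((hq₂lim n) M).div_const (r : ℂ)
      · intro M
        have h1 := (hβ M).const_mul (r : ℂ)
        rw [← Complex.ofReal_mul, hrβ] at h1
        refine h1.congr fun z => ?_
        rw [div_div_eq_mul_div]
        ring
      · rw [mul_div_cancel₀ _ hrc]
  refine ⟨r, fun z => -(1 - z) ^ 2 / g z, hr, isSemigroupGenerator_of_re_nonneg hgd hgre hg0,
    fun z hz => div_ne_zero (neg_ne_zero.2 (pow_ne_zero 2 (h1z z hz))) (hg0 z hz),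
    hasAngularDeriv_of_quotient norm_one (hg1.congr fun z hz => ?_),
    fun n => angularTendsto_cobounded (hζ_norm n) (hζ_ne n) hg0 (hglim n), fun z hz => ?_⟩
  · have e1 := h1z z hz
    have e2 := hg0 z hz
    rw [show z - 1 = -(1 - z) by ring]
    field_simp
  · have e1 := h1z z hz
    have e2 := hg0 z hz
    have e3 := hf0 z hz
    have hsum : ∑ n, (1 / (‖d n‖ : ℂ)) * (1 / (z - 1) - 1 / (z - ζ n)) = -(T z / (1 - z)) := by
      simp only [T]
      rw [Finset.sum_div, ← Finset.sum_neg_distrib]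
      refine Finset.sum_congr rfl fun n _ => ?_
      have e4 := hzζ n z hz
      have e5 : z - 1 ≠ 0 := by rw [← neg_sub]; exact neg_ne_zero.2 e1
      rw [mul_div_assoc, ← mul_neg]
      congr 1
      rw [show 1 - z = -(z - 1) by ring]
      field_simp
      ring
    have hq₂z : r * g z = -(1 - z) ^ 2 / f z - (1 - z) * T z := by
      rw [← hrg z hz]
      simp only [q₂, q, p]
      rw [inv_div, div_neg, neg_div]
    have hrh : (r : ℂ) / (-(1 - z) ^ 2 / g z) = -(r * g z) / (1 - z) ^ 2 := by
      field_simp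
    rw [hsum, hrh, hq₂z]
    field_simp
    ring
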